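/- Let $\mathbb S(p)$ be the space of real symmetric $p\times p$ matrices with $U\bullet X=\operatorname{trace}(UX)$, let $\mathcal{COP}(p)=\{D\in\mathbb S(p): t^\top Dt\ge 0\ \forall t\in\mathbb R^p_+\}$, let $\mathcal{CP}(p)=\{U\in\mathbb S(p): U\bullet X\ge 0\ \forall X\in\mathcal{COP}(p)\}=\operatorname{cone}\{tt^\top:t\in\mathbb R^p_+\}$ be its dual cone, and let $\mathbb C(\mathcal{COP})=\{(X,U): X\in\mathcal{COP}(p),\ U\in\mathcal{CP}(p),\ X\bullet U=0\}$. Let $(X^0,U^0)\in\mathbb C(\mathcal{COP})$ be such that the set $T_a(X^0)=\{t\in\mathbb R^p_+: \sum_k t_k=1,\ t^\top X^0t=0\}$ is nonempty. Let $\tau(j)$, $j\in J$, be the vertices of $\operatorname{conv}T_a(X^0)$ and $M(j)=\{k: e_k^\top X^0\tau(j)=0\}$. Let $J(s)$, $s\in S$, be a finite family of subsets of $J$ (possibly overlapping), with $|S|\ge 1$ the largest possible, such that a) $J=\bigcup_{s\in S}J(s)$; b) $\bigcup_{j\in J(s)}\operatorname{supp}\tau(j)\subset M(i)$ for all $i\in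 J(s)$, $s\in S$; c) for all $s\ne\bar s$ in $S$: $J(s)\setminus J(\bar s)\ne\emptyset$, $J(\bar s)\setminus J(s)\neq\emptyset$, and for every $i_0\in J(s)\setminus J(\bar s)$ there are $j_0\in J(\bar s)\setminus J(s)$ and $k_0\in\operatorname{supp}\tau(i_0)$ with $k_0\notin M(j_0)$. Put $P_*(s)=\bigcup_{j\in J(s)}\operatorname{supp}\tau(j)$ and $p(s)=|P_*(s)|$, and choose $J_b(s)\subset J(s)$ with $\operatorname{rank}(\tau(j),j\in J(s))=\operatorname{rank}(\tau(j),j\in J_b(s))=|J_b(s)|$. For $X\in\mathbb S(p)$ let $\mathcal A(X,s)\in\mathbb S(p(s))$ be the principal submatrix of $X$ with rows and columns in $P_*(s)$, and for $W\in\mathbb S(p(s))$ let $\mathcal B(W,s)\in\mathbb S(p)$ be the matrix with block $W$ on $P_*(s)\times P_*(s)$ and zeros elsewhere. Assume: j) $U^0$ is strictly complementary to $X^0$, i.e. $U^0$ belongs to the relative interior of $\{U\in\mathcal{CP}(p): X^0\bullet U=0\}$; jj) the matrices $(\tau(i)+\tau(j))(\tau(i)+\tau(j))^\top$, $i,j\in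 J_b(s)$, $i\le j$, $s\in S$, are linearly independent (as a family indexed by $s$ and the unordered pair $i,j$, with $i=j$ allowed); jjj) $M(j)=P_*(s)$ for all $j\in J(s)$, $s\in S$. Then for any $(X(\varepsilon),U(\varepsilon))\in\mathbb C(\mathcal{COP})$, defined for all sufficiently small $\varepsilon\ge 0$, with $X(\varepsilon)\to X^0$ and $U(\varepsilon)\to U^0$ as $\varepsilon\to 0$, where $(X(0),U(0))=(X^0,U^0)$, there exist $\varepsilon_0>0$ and matrix functions $W(s,\varepsilon)\in\mathbb S(p(s))$, $s\in S$, $\varepsilon\in[0,\varepsilon_0]$, such that for all $\varepsilon\in[0,\varepsilon_0]$ $$\mathcal A(X(\varepsilon),s)W(s,\varepsilon)+W(s,\varepsilon)\mathcal A(X(\varepsilon),s)=0\quad\forall s\in S,\qquad U(\varepsilon)=\sum_{s\in S}\mathcal B(W(s,\varepsilon),s).$$ -/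

import Mathlib

open Filter Topology Matrix

noncomputable section

/-- The cone of copositive `p × p` matrices. -/
def copositiveCone (p : ℕ) : Set (Matrix (Fin p) (Fin p) ℝ) :=
  {D | D.IsSymm ∧ ∀ t : Fin p → ℝ, (∀ k, 0 ≤ t k) → 0 ≤ t ⬝ᵥ D *ᵥ t}

/-- The dual of a set of symmetric matrices, inside the space of symmetric matrices, for the
inner product `U • X = trace (U X)`. -/
def symmDual {p : ℕ} (K : Set (Matrix (Fin p) (Fin p) ℝ)) : Set (Matrix (Fin p) (Fin p) ℝ) :=
  {U | U.IsSymm ∧ ∀ X ∈ K, 0 ≤ (U * X).trace}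

/-- The cone of completely positive `p × p` matrices, as the dual of the copositive cone. -/
def completelyPositiveCone (p : ℕ) : Set (Matrix (Fin p) (Fin p) ℝ) :=
  symmDual (copositiveCone p)

/-- The complementarity set of the copositive cone. -/
def complementaritySet (p : ℕ) : Set (Matrix (Fin p) (Fin p) ℝ × Matrix (Fin p) (Fin p) ℝ) :=
  {XU | XU.1 ∈ copositiveCone p ∧ XU.2 ∈ completelyPositiveCone p ∧ (XU.1 * XU.2).trace = 0}

/-- The orthogonal complement of `X` in the space of symmetric matrices. -/
def symmOrthogonal {p : ℕ} (X : Matrix (Fin p) (Fin p) ℝ) : Set (Matrix (Fin p) (Fin p) ℝ) :=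
  {U | U.IsSymm ∧ (X * U).trace = 0}

/-- `U` is strictly complementary to `X`: `U` lies in the relative interior of the face of
the completely positive cone cut out by `X`. -/
def StrictlyComplementary {p : ℕ} (U X : Matrix (Fin p) (Fin p) ℝ) : Prop :=
  U ∈ intrinsicInterior ℝ (completelyPositiveCone p ∩ symmOrthogonal X)

/-- The normalized zeros of the quadratic form of `X` on the nonnegative orthant. -/
def normalizedZeros {p : ℕ} (X : Matrix (Fin p) (Fin p) ℝ) : Set (Fin p → ℝ) :=
  {t | t ∈ stdSimplex ℝ (Fin p) ∧ t ⬝ᵥ X *ᵥ t = 0}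

/-- The vertices `τ(j)`, `j ∈ J`, of the convex hull of the normalized zeros. The vertices
serve as their own indices. -/
def zeroVertices {p : ℕ} (X : Matrix (Fin p) (Fin p) ℝ) : Set (Fin p → ℝ) :=
  (convexHull ℝ (normalizedZeros X)).extremePoints ℝ

/-- The index set `M(j)` of the vertex `τ = τ(j)`. -/
def zeroIndices {p : ℕ} (X : Matrix (Fin p) (Fin p) ℝ) (τ : Fin p → ℝ) : Set (Fin p) :=
  {k | (X *ᵥ τ) k = 0}

/-- A family `J(s)`, `s ∈ Fin m`, of subsets of the vertex set such that:
it covers the vertex set, the supports within one part are compatible, and different parts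
contain incompatible vertices. The parts may overlap. -/
structure IsVertexPartition {p : ℕ} (X : Matrix (Fin p) (Fin p) ℝ) (m : ℕ)
    (J : Fin m → Set (Fin p → ℝ)) : Prop where
  one_le : 1 ≤ m
  cover : ⋃ s, J s = zeroVertices X
  compatible : ∀ s, ∀ i ∈ J s, ⋃ j ∈ J s, Function.support j ⊆ zeroIndices X i
  separated : ∀ s s', s ≠ s' →
    (J s \ J s').Nonempty ∧ (J s' \ J s).Nonempty ∧
    ∀ i₀ ∈ J s \ J s', ∃ j₀ ∈ J s' \ J s, ∃ k₀ ∈ Function.support i₀, k₀ ∉ zeroIndices X j₀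

/-- Such a family with the maximum number of parts. -/
def IsMaximumVertexPartition {p : ℕ} (X : Matrix (Fin p) (Fin p) ℝ) (m : ℕ)
    (J : Fin m → Set (Fin p → ℝ)) : Prop :=
  IsVertexPartition X m J ∧
    ∀ (m' : ℕ) (J' : Fin m' → Set (Fin p → ℝ)), IsVertexPartition X m' J' → m' ≤ m

open Classical in
/-- The union `P_*(s)` of the supports of the vertices in one part. -/
def supportIndices {p : ℕ} (I : Set (Fin p → ℝ)) : Finset (Fin p) :=
  Finset.univ.filter fun k => ∃ τ ∈ I, k ∈ Function.support τ

/-- `I_b ⊆ I` with `rank I = rank I_b = |I_b|`. -/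
def IsRankBasis {p : ℕ} (I Ib : Set (Fin p → ℝ)) : Prop :=
  Ib ⊆ I ∧ Set.finrank ℝ I = Set.finrank ℝ Ib ∧ Ib.Finite ∧ Set.finrank ℝ Ib = Ib.ncard

/-- The matrix `(τ(i) + τ(j)) (τ(i) + τ(j))ᵀ` of an unordered pair (possibly `i = j`). -/
def pairMatrix {p : ℕ} {I : Set (Fin p → ℝ)} : Sym2 I → Matrix (Fin p) (Fin p) ℝ :=
  Sym2.lift ⟨fun i j => vecMulVec (i.1 + j.1) (i.1 + j.1), fun i j => by
    simp only [add_comm]⟩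

/-- The principal submatrix `𝒜(X, s)` of `X` with index set `P = P_*(s)`. -/
def restrictMatrix {p : ℕ} (P : Finset (Fin p)) (X : Matrix (Fin p) (Fin p) ℝ) :
    Matrix P P ℝ :=
  X.submatrix (fun k => k.1) (fun k => k.1)

/-- The extension `ℬ(W, s)` of `W` by zero from the index set `P = P_*(s)`. -/
def extendMatrix {p : ℕ} (P : Finset (Fin p)) (W : Matrix P P ℝ) :
    Matrix (Fin p) (Fin p) ℝ :=
  Matrix.of fun k q => if h : k ∈ P ∧ q ∈ P then W ⟨k, h.1⟩ ⟨q, h.2⟩ else 0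

end

/-!
The zeros of a copositive form `X` near `X₀` are supported in one of the sets `P_*(s)`, because the
gradient `X₀ t` is positive outside `P_*(s)` at the zeros `t` of `X₀` in the convex hull of `J(s)`
(`IsVertexPartition.eventually_exists_support_subset`). A completely positive matrix is a sum of
matrices `v vᵀ` with `v ≥ 0` (`mem_rankOneSums_of_mem_completelyPositiveCone`), and if it is
complementary to `X` every such `v` is a zero of `X`. Hence `U` is a sum of completely positive
blocks `W(s)` supported in `P_*(s)` and complementary to `X`, and it remains to show that the
principal blocks of `X` and `W(s)` have product zero.

As `(X, U)` tends to `(X₀, U₀)`, the blocks are bounded, and each limit lies in the cone generated by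
the `v vᵀ` with `v` a nonnegative combination of the vertices in `J(s)`. By linear independence of
the pair matrices the limits are determined by their sum `U₀`; by strict complementarity they
contain every pair matrix with a positive coefficient
(`IsVertexPartition.exists_sum_add_pair`).

On one face the problem is the following. The block `Y₀` of `X₀` is positive semidefinite, since it
is copositive with a positive vector in its kernel, and this kernel is spanned by `J(s)`. Let the
columns of `B` be a basis of the kernel consisting of vertices. For a copositive `Y` near `Y₀`, the
parallel sum `Z = Y - Y (Y + B Bᵀ)⁻¹ Y` of `Y` and `B Bᵀ` has the form `B C Bᵀ`. It is bounded above
by `Y`, so it is nonpositive against any completely positive `W` complementary to `Y`; and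
`l · Z l ≥ a · Y a` for a vector `a` that tends to `l` as `Y` tends to `Y₀`, so `l · Z l` is
eventually nonnegative for every positive `l` in the kernel. If `Z` does not vanish, a limit of its
normalizations is a nonzero form that is nonnegative on the nonnegative part of the kernel and
nonpositive against a relative interior point of the corresponding face, which is impossible. So
`Z = 0`, the matrix `Y = Y (Y + B Bᵀ)⁻¹ Y` is positive semidefinite, and `Y W = 0`
(`eventually_mul_eq_zero_of_trace_eq_zero`).
-/

/-! ### Cones generated by rank-one matrices -/

/-- The set of finite sums `∑ v vᵀ` with all `v` in `A`. If `A` is closed under multiplication by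
positive scalars, this is the convex cone generated by the matrices `v vᵀ`, `v ∈ A`. -/
def rankOneSums {ι : Type*} (A : Set (ι → ℝ)) : AddSubmonoid (Matrix ι ι ℝ) :=
  AddSubmonoid.closure ((fun v => vecMulVec v v) '' A)

section RankOneSums

variable {ι : Type*} {A B : Set (ι → ℝ)}

theorem vecMulVec_mem_rankOneSums {v : ι → ℝ} (hv : v ∈ A) : vecMulVec v v ∈ rankOneSums A :=
  AddSubmonoid.subset_closure ⟨v, hv, rfl⟩

theorem rankOneSums_induction {motive : Matrix ι ι ℝ → Prop}
    (mem : ∀ v ∈ A, motive (vecMulVec v v)) (zero : motive 0)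
    (add : ∀ V W, motive V → motive W → motive (V + W))
    {W : Matrix ι ι ℝ} (hW : W ∈ rankOneSums A) : motive W := by
  refine AddSubmonoid.closure_induction (motive := fun W _ => motive W) ?_ zero
    (fun V W _ _ hV hW => add V W hV hW) hW
  rintro _ ⟨v, hv, rfl⟩
  exact mem v hv

theorem rankOneSums_mono (h : A ⊆ B) : rankOneSums A ≤ rankOneSums B :=
  AddSubmonoid.closure_mono (Set.image_mono h)

theorem isSymm_of_mem_rankOneSums {W : Matrix ι ι ℝ} (hW : W ∈ rankOneSums A) : W.IsSymm := by
  refine rankOneSums_induction (fun v _ => ?_) ?_ (fun V W hV hW => hV.add hW) hW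
  · ext i j
    simp [vecMulVec_apply, mul_comm]
  · simp [Matrix.IsSymm]

theorem smul_mem_rankOneSums (hA : ∀ c : ℝ, 0 ≤ c → ∀ v ∈ A, c • v ∈ A) {c : ℝ} (hc : 0 ≤ c)
    {W : Matrix ι ι ℝ} (hW : W ∈ rankOneSums A) : c • W ∈ rankOneSums A := by
  refine rankOneSums_induction (motive := fun W => c • W ∈ rankOneSums A) (fun v hv => ?_) ?_
    (fun V W hV hW => ?_) hW
  · have : c • vecMulVec v v = vecMulVec (√c • v) (√c • v) := by
      rw [smul_vecMulVec, vecMulVec_smul, smul_smul, Real.mul_self_sqrt hc]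
    rw [this]
    exact vecMulVec_mem_rankOneSums (hA _ (Real.sqrt_nonneg c) v hv)
  · simp
  · rw [smul_add]
    exact add_mem hV hW

theorem apply_nonneg_of_mem_rankOneSums (hA : ∀ v ∈ A, ∀ k, 0 ≤ v k) {W : Matrix ι ι ℝ}
    (hW : W ∈ rankOneSums A) (i j : ι) : 0 ≤ W i j :=
  rankOneSums_induction (motive := fun W => 0 ≤ W i j)
    (fun v hv => mul_nonneg (hA v hv i) (hA v hv j)) le_rfl (fun _ _ hV hW => add_nonneg hV hW) hW

/-- A sum of rank-one matrices over a finite union of sets can be grouped by the sets. -/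
theorem exists_sum_of_mem_rankOneSums {σ : Type*} [Fintype σ]
    {A : σ → Set (ι → ℝ)} {W : Matrix ι ι ℝ} (hW : W ∈ rankOneSums (⋃ s, A s)) :
    ∃ V : σ → Matrix ι ι ℝ, (∀ s, V s ∈ rankOneSums (A s)) ∧ W = ∑ s, V s := by
  classical
  refine rankOneSums_induction (motive := fun W => ∃ V : σ → Matrix ι ι ℝ,
    (∀ s, V s ∈ rankOneSums (A s)) ∧ W = ∑ s, V s) (fun v hv => ?_)
    ⟨0, fun s => zero_mem _, by simp⟩ ?_ hW
  · obtain ⟨s, hs⟩ := Set.mem_iUnion.1 hv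
    refine ⟨Pi.single s (vecMulVec v v), fun s' => ?_, by simp⟩
    by_cases h : s' = s
    · subst h
      simpa using vecMulVec_mem_rankOneSums hs
    · simp [h]
  · rintro _ _ ⟨V, hV, rfl⟩ ⟨V', hV', rfl⟩
    exact ⟨V + V', fun s => add_mem (hV s) (hV' s), by simp [Finset.sum_add_distrib]⟩

variable [Fintype ι]

theorem trace_mul_vecMulVec_self (X : Matrix ι ι ℝ) (v : ι → ℝ) :
    (X * vecMulVec v v).trace = v ⬝ᵥ X *ᵥ v := by
  rw [mul_vecMulVec, trace_vecMulVec, dotProduct_comm]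

theorem trace_mul_nonneg_of_mem_rankOneSums {X W : Matrix ι ι ℝ}
    (hX : ∀ v ∈ A, 0 ≤ v ⬝ᵥ X *ᵥ v) (hW : W ∈ rankOneSums A) : 0 ≤ (X * W).trace := by
  refine rankOneSums_induction (motive := fun W => 0 ≤ (X * W).trace) (fun v hv => ?_) (by simp)
    (fun V W hV hW => ?_) hW
  · rw [trace_mul_vecMulVec_self]
    exact hX v hv
  · rw [mul_add, trace_add]
    exact add_nonneg hV hW

/-- Complementarity passes to the rank-one summands: they are zeros of the quadratic form. -/
theorem mem_rankOneSums_zeros {X W : Matrix ι ι ℝ}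
    (hX : ∀ v ∈ A, 0 ≤ v ⬝ᵥ X *ᵥ v) (hW : W ∈ rankOneSums A) (h : (X * W).trace = 0) :
    W ∈ rankOneSums {v | v ∈ A ∧ v ⬝ᵥ X *ᵥ v = 0} := by
  refine (rankOneSums_induction (motive := fun W => 0 ≤ (X * W).trace ∧ ((X * W).trace = 0 →
    W ∈ rankOneSums {v | v ∈ A ∧ v ⬝ᵥ X *ᵥ v = 0})) (fun v hv => ?_) (by simp)
    (fun V W hV hW => ?_) hW).2 h
  · rw [trace_mul_vecMulVec_self]
    exact ⟨hX v hv, fun h => vecMulVec_mem_rankOneSums ⟨hv, h⟩⟩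
  · rw [mul_add, trace_add]
    exact ⟨add_nonneg hV.1 hW.1, fun h => add_mem (hV.2 (by linarith [hV.1, hW.1]))
      (hW.2 (by linarith [hV.1, hW.1]))⟩

end RankOneSums

/-! ### Completely positive matrices are sums of nonnegative rank-one matrices -/

/-- In finite dimension the convex hull of a compact set is compact, by Carathéodory's theorem. -/
theorem isCompact_convexHull_of_finiteDimensional {E : Type*} [AddCommGroup E] [Module ℝ E]
    [TopologicalSpace E] [IsTopologicalAddGroup E] [ContinuousSMul ℝ E] [FiniteDimensional ℝ E]
    {T : Set E} (hT : IsCompact T) : IsCompact (convexHull ℝ T) := by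
  have key : convexHull ℝ T = ⋃ n ∈ Finset.range (Module.finrank ℝ E + 2),
      (fun q : (Fin n → ℝ) × (Fin n → E) => ∑ i, q.1 i • q.2 i) ''
        (stdSimplex ℝ (Fin n) ×ˢ Set.univ.pi fun _ => T) := by
    ext x
    simp only [Set.mem_iUnion, Finset.mem_range]
    constructor
    · intro hx
      obtain ⟨κ, _, z, w, hz, hai, hw, hw1, rfl⟩ := eq_pos_convex_span_of_mem_convexHull hx
      have hcard : Fintype.card κ ≤ Module.finrank ℝ E + 1 :=
        hai.card_le_finrank_succ.trans (Nat.succ_le_succ (Submodule.finrank_le _))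
      let e := (Fintype.equivFin κ).symm
      refine ⟨Fintype.card κ, by omega, (w ∘ e, z ∘ e), ⟨⟨fun i => (hw _).le, ?_⟩, fun i _ => ?_⟩, ?_⟩
      · rw [← hw1]
        exact e.sum_comp w
      · exact hz ⟨_, rfl⟩
      · exact e.sum_comp fun i => w i • z i
    · rintro ⟨n, _, ⟨w, z⟩, ⟨hw, hz⟩, rfl⟩
      exact mem_convexHull_of_exists_fintype w z hw.1 hw.2 (fun i => hz i trivial) rfl
  rw [key]
  refine (Finset.range _).isCompact_biUnion fun n _ => ?_
  refine ((isCompact_stdSimplex ℝ (Fin n)).prod (isCompact_univ_pi fun _ => hT)).image ?_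
  fun_prop

/-- Every linear functional on square matrices agrees on symmetric matrices with the trace pairing
against a symmetric matrix. -/
theorem exists_isSymm_trace_eq {p : ℕ} (f : Matrix (Fin p) (Fin p) ℝ →ₗ[ℝ] ℝ) :
    ∃ D : Matrix (Fin p) (Fin p) ℝ, D.IsSymm ∧
      ∀ U : Matrix (Fin p) (Fin p) ℝ, U.IsSymm → f U = (U * D).trace := by
  let C : Matrix (Fin p) (Fin p) ℝ := fun i j => f (Matrix.single i j 1)
  have hf : ∀ U : Matrix (Fin p) (Fin p) ℝ, f U = ∑ i, ∑ j, U i j * C i j := by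
    intro U
    conv_lhs => rw [matrix_eq_sum_single U]
    simp only [map_sum]
    refine Finset.sum_congr rfl fun i _ => Finset.sum_congr rfl fun j _ => ?_
    have : Matrix.single i j (U i j) = U i j • Matrix.single i j (1 : ℝ) := by simp
    rw [this, map_smul, smul_eq_mul]
  refine ⟨(1 / 2 : ℝ) • (C + Cᵀ), ?_, fun U hU => ?_⟩
  · rw [Matrix.IsSymm, transpose_smul, transpose_add, transpose_transpose, add_comm]
  · have h1 : (U * C).trace = f U := by
      rw [hf, Finset.sum_comm]
      simp only [trace, diag, mul_apply]
      refine Finset.sum_congr rfl fun i _ => Finset.sum_congr rfl fun j _ => ?_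
      rw [hU.apply]
    have h2 : (U * Cᵀ).trace = f U := by
      rw [← h1, ← trace_transpose, transpose_mul, transpose_transpose, hU.eq, trace_mul_comm]
    rw [Matrix.mul_smul, trace_smul, mul_add, trace_add, h1, h2, smul_eq_mul]
    ring

theorem mem_completelyPositiveCone_of_mem_rankOneSums {p : ℕ} {U : Matrix (Fin p) (Fin p) ℝ}
    (hU : U ∈ rankOneSums {v | ∀ k, 0 ≤ v k}) : U ∈ completelyPositiveCone p := by
  refine ⟨isSymm_of_mem_rankOneSums hU, fun X hX => ?_⟩
  rw [trace_mul_comm]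
  exact trace_mul_nonneg_of_mem_rankOneSums hX.2 hU

theorem trace_mul_of_one {p : ℕ} (U : Matrix (Fin p) (Fin p) ℝ) :
    (U * Matrix.of fun _ _ => (1 : ℝ)).trace = ∑ i, ∑ j, U i j := by
  simp [trace, mul_apply]

theorem dotProduct_mulVec_of_one {p : ℕ} (t : Fin p → ℝ) :
    t ⬝ᵥ (Matrix.of fun _ _ => (1 : ℝ)) *ᵥ t = (∑ k, t k) ^ 2 := by
  simp [dotProduct, mulVec, ← Finset.sum_mul, sq]

theorem isSymm_of_one {p : ℕ} :
    (Matrix.of fun _ _ => (1 : ℝ) : Matrix (Fin p) (Fin p) ℝ).IsSymm := by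
  ext
  simp

/-- A copositive form is determined by its values on the standard simplex. -/
theorem mem_copositiveCone_of_forall_stdSimplex {p : ℕ} {D : Matrix (Fin p) (Fin p) ℝ}
    (hD : D.IsSymm) (h : ∀ t ∈ stdSimplex ℝ (Fin p), 0 ≤ t ⬝ᵥ D *ᵥ t) :
    D ∈ copositiveCone p := by
  refine ⟨hD, fun t ht => ?_⟩
  rcases (Finset.sum_nonneg fun k _ => ht k).eq_or_lt with h0 | hpos
  · have : t = 0 := by
      ext k
      exact (Finset.sum_eq_zero_iff_of_nonneg fun k _ => ht k).1 h0.symm k (Finset.mem_univ k)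
    simp [this]
  · have := h ((∑ k, t k)⁻¹ • t) ⟨fun k => mul_nonneg (inv_nonneg.2 hpos.le) (ht k), by
      simp only [Pi.smul_apply, smul_eq_mul]
      rw [← Finset.mul_sum, inv_mul_cancel₀ hpos.ne']⟩
    rw [mulVec_smul, smul_dotProduct, dotProduct_smul, smul_smul, smul_eq_mul] at this
    exact nonneg_of_mul_nonneg_right this (by positivity)

/-- A completely positive matrix whose entries sum to zero vanishes: `λ E - U` is copositive for
large `λ`, where `E` is the all-ones matrix. -/
theorem eq_zero_of_sum_eq_zero {p : ℕ} {U : Matrix (Fin p) (Fin p) ℝ}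
    (hU : U ∈ completelyPositiveCone p) (h : ∑ i, ∑ j, U i j = 0) : U = 0 := by
  set a : ℝ := ∑ i, ∑ j, |U i j| with ha
  have hle : ∀ i j, U i j ≤ a := fun i j =>
    (le_abs_self _).trans <|
      (Finset.single_le_sum (f := fun j => |U i j|) (fun _ _ => abs_nonneg _)
        (Finset.mem_univ j)).trans <|
      Finset.single_le_sum (f := fun i => ∑ j, |U i j|)
        (fun _ _ => Finset.sum_nonneg fun _ _ => abs_nonneg _) (Finset.mem_univ i)
  have hcop : a • (Matrix.of fun _ _ => (1 : ℝ)) - U ∈ copositiveCone p := by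
    refine ⟨(isSymm_of_one.smul a).sub hU.1, fun t ht => ?_⟩
    refine Finset.sum_nonneg fun i _ => mul_nonneg (ht i) ?_
    rw [mulVec, dotProduct]
    refine Finset.sum_nonneg fun j _ => mul_nonneg ?_ (ht j)
    simpa using hle i j
  have := hU.2 _ hcop
  rw [mul_sub, Matrix.mul_smul, trace_sub, trace_smul, trace_mul_of_one, h, smul_zero,
    zero_sub] at this
  have h2 : (U * U).trace = ∑ i, ∑ j, U i j * U i j := by
    simp only [trace, diag, mul_apply]
    refine Finset.sum_congr rfl fun i _ => Finset.sum_congr rfl fun j _ => ?_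
    rw [hU.1.apply]
  have h3 : ∑ i, ∑ j, U i j * U i j = 0 :=
    le_antisymm (by linarith)
      (Finset.sum_nonneg fun _ _ => Finset.sum_nonneg fun _ _ => mul_self_nonneg _)
  ext i j
  have h4 := (Finset.sum_eq_zero_iff_of_nonneg (f := fun i => ∑ j, U i j * U i j)
    fun _ _ => Finset.sum_nonneg fun _ _ => mul_self_nonneg _).1 h3 i (Finset.mem_univ i)
  have h5 := (Finset.sum_eq_zero_iff_of_nonneg (f := fun j => U i j * U i j)
    fun _ _ => mul_self_nonneg _).1 h4 j (Finset.mem_univ j)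
  simpa using h5

/-- The dual of the copositive cone consists of the sums `∑ v vᵀ` with `v ≥ 0`. A matrix with entry
sum `c > 0` outside these sums is separated, after division by `c`, from the compact convex hull of
the `t tᵀ` with `t` in the simplex, and the separating functional gives a copositive form. -/
theorem mem_rankOneSums_of_mem_completelyPositiveCone {p : ℕ} {U : Matrix (Fin p) (Fin p) ℝ}
    (hU : U ∈ completelyPositiveCone p) : U ∈ rankOneSums {v | ∀ k, 0 ≤ v k} := by
  have hscale : ∀ c : ℝ, 0 ≤ c → ∀ v ∈ {v : Fin p → ℝ | ∀ k, 0 ≤ v k},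
      c • v ∈ {v : Fin p → ℝ | ∀ k, 0 ≤ v k} := fun c hc v hv k => mul_nonneg hc (hv k)
  have hE : (Matrix.of fun _ _ => (1 : ℝ)) ∈ copositiveCone p :=
    ⟨isSymm_of_one, fun t _ => by rw [dotProduct_mulVec_of_one]; positivity⟩
  set c : ℝ := ∑ i, ∑ j, U i j with hc
  have hc0 : 0 ≤ c := by
    rw [hc, ← trace_mul_of_one]
    exact hU.2 _ hE
  rcases hc0.eq_or_lt with h0 | hpos
  · rw [eq_zero_of_sum_eq_zero hU h0.symm]
    exact zero_mem _
  let T : Set (Matrix (Fin p) (Fin p) ℝ) := (fun t => vecMulVec t t) '' stdSimplex ℝ (Fin p)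
  have hT : IsCompact T :=
    (isCompact_stdSimplex ℝ (Fin p)).image (continuous_id.matrix_vecMulVec continuous_id)
  have hconv : Convex ℝ (rankOneSums {v : Fin p → ℝ | ∀ k, 0 ≤ v k} :
      Set (Matrix (Fin p) (Fin p) ℝ)) := fun V hV W hW a b ha hb _ =>
    add_mem (smul_mem_rankOneSums hscale ha hV) (smul_mem_rankOneSums hscale hb hW)
  have hsub : convexHull ℝ T ⊆ rankOneSums {v : Fin p → ℝ | ∀ k, 0 ≤ v k} := by
    refine convexHull_min ?_ hconv
    rintro _ ⟨t, ht, rfl⟩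
    exact vecMulVec_mem_rankOneSums ht.1
  suffices c⁻¹ • U ∈ convexHull ℝ T by
    have := smul_mem_rankOneSums hscale hc0 (hsub this)
    rwa [smul_smul, mul_inv_cancel₀ hpos.ne', one_smul] at this
  by_contra hnot
  have : LocallyConvexSpace ℝ (Matrix (Fin p) (Fin p) ℝ) :=
    inferInstanceAs (LocallyConvexSpace ℝ (Fin p → Fin p → ℝ))
  obtain ⟨f, u, hfu, hfT⟩ := geometric_hahn_banach_point_closed (convex_convexHull ℝ T)
    (isCompact_convexHull_of_finiteDimensional hT).isClosed hnot
  obtain ⟨D, hD, hfD⟩ := exists_isSymm_trace_eq (f : Matrix (Fin p) (Fin p) ℝ →ₗ[ℝ] ℝ)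
  have hcop : D - u • (Matrix.of fun _ _ => (1 : ℝ)) ∈ copositiveCone p := by
    refine mem_copositiveCone_of_forall_stdSimplex (hD.sub (isSymm_of_one.smul u)) fun t ht => ?_
    have h1 := hfT _ (subset_convexHull ℝ T ⟨t, ht, rfl⟩)
    have h2 := hfD (vecMulVec t t)
      (isSymm_of_mem_rankOneSums (vecMulVec_mem_rankOneSums (Set.mem_singleton t)))
    rw [trace_mul_comm, trace_mul_vecMulVec_self] at h2
    rw [sub_mulVec, dotProduct_sub, smul_mulVec, dotProduct_smul, dotProduct_mulVec_of_one, ht.2,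
      ← h2]
    simpa using h1.le
  have h3 := hU.2 _ hcop
  have h4 := hfD U hU.1
  rw [mul_sub, Matrix.mul_smul, trace_sub, trace_smul, trace_mul_of_one, ← hc, ← h4,
    smul_eq_mul] at h3
  rw [map_smul, smul_eq_mul, inv_mul_lt_iff₀ hpos] at hfu
  have h5 : f U = (f : Matrix (Fin p) (Fin p) ℝ →ₗ[ℝ] ℝ) U := rfl
  linarith

/-! ### Limits of quadratic forms -/

section Limits

variable {ι : Type*} [Fintype ι]

theorem tendsto_dotProduct_mulVec {α : Type*} {F : Filter α} {T : α → Matrix ι ι ℝ}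
    {a : α → ι → ℝ} {S : Matrix ι ι ℝ} {b : ι → ℝ} (hT : Tendsto T F (𝓝 S))
    (ha : Tendsto a F (𝓝 b)) :
    Tendsto (fun x => a x ⬝ᵥ T x *ᵥ a x) F (𝓝 (b ⬝ᵥ S *ᵥ b)) := by
  have hc : Continuous fun q : Matrix ι ι ℝ × (ι → ℝ) => q.2 ⬝ᵥ q.1 *ᵥ q.2 :=
    continuous_snd.dotProduct (continuous_fst.matrix_mulVec continuous_snd)
  exact (hc.tendsto (S, b)).comp (hT.prodMk_nhds ha)

/-- Positive definiteness is an open condition among symmetric matrices. -/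
theorem eventually_posDef {S : Matrix ι ι ℝ} (hS : S.PosDef) :
    ∀ᶠ T in 𝓝 S, T.IsSymm → T.PosDef := by
  have hcont : Continuous fun q : Matrix ι ι ℝ × (ι → ℝ) => q.2 ⬝ᵥ q.1 *ᵥ q.2 :=
    continuous_snd.dotProduct (continuous_fst.matrix_mulVec continuous_snd)
  have := (isCompact_sphere (0 : ι → ℝ) 1).eventually_forall_of_forall_eventually (x₀ := S)
    (P := fun T u => 0 < u ⬝ᵥ T *ᵥ u) fun u hu => by
      have hu0 : u ≠ 0 := by
        rintro rfl
        simp at hu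
      have hpos : 0 < u ⬝ᵥ S *ᵥ u := by simpa using hS.dotProduct_mulVec_pos hu0
      exact (hcont.tendsto (S, u)).eventually (lt_mem_nhds hpos)
  filter_upwards [this] with T hT hsymm
  refine PosDef.of_dotProduct_mulVec_pos
    (by rw [IsHermitian, conjTranspose_eq_transpose_of_trivial, hsymm.eq]) fun u hu => ?_
  have hn : 0 < ‖u‖ := norm_pos_iff.2 hu
  have := hT (‖u‖⁻¹ • u) (by simp [norm_smul, hn.ne'])
  rw [mulVec_smul, smul_dotProduct, dotProduct_smul, smul_smul, smul_eq_mul] at this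
  rw [star_trivial]
  exact pos_of_mul_pos_right this (by positivity)

theorem tendsto_inv_of_posDef [DecidableEq ι] {S : Matrix ι ι ℝ} (hS : S.PosDef) :
    Tendsto (fun T : Matrix ι ι ℝ => T⁻¹) (𝓝 S) (𝓝 S⁻¹) := by
  have hdet : S.det ≠ 0 := ((isUnit_iff_isUnit_det _).1 hS.isUnit).ne_zero
  simp only [Matrix.inv_def, Ring.inverse_eq_inv']
  have h1 : Continuous fun T : Matrix ι ι ℝ => T.det := continuous_id.matrix_det
  have h2 : Continuous fun T : Matrix ι ι ℝ => T.adjugate := continuous_id.matrix_adjugate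
  exact ((h1.tendsto S).inv₀ hdet).smul (h2.tendsto S)

end Limits

/-! ### The parallel sum with a Gram matrix -/

section ParallelSum

variable {ι κ : Type*} [Fintype ι] [DecidableEq ι] [Fintype κ]

/-- With `S = Y + B Bᵀ`, the matrix `B (gramDefect B Y) Bᵀ` is the parallel sum of `Y` and `B Bᵀ`.
The factor `1 - Bᵀ S⁻¹ B` between `B` and `Bᵀ` has the size of the column index set of `B`. -/
noncomputable def gramDefect [DecidableEq κ] (B : Matrix ι κ ℝ) (Y : Matrix ι ι ℝ) : Matrix κ κ ℝ :=
  1 - Bᵀ * (Y + B * Bᵀ)⁻¹ * B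

variable {B : Matrix ι κ ℝ} {Y : Matrix ι ι ℝ}

theorem mul_gramDefect_mul_eq_sub [DecidableEq κ] :
    B * gramDefect B Y * Bᵀ = B * Bᵀ - B * Bᵀ * ((Y + B * Bᵀ)⁻¹ * (B * Bᵀ)) := by
  simp only [gramDefect, Matrix.mul_sub, Matrix.sub_mul, Matrix.mul_one, Matrix.mul_assoc]

theorem mul_gramDefect_mul [DecidableEq κ] (hS : (Y + B * Bᵀ).PosDef) :
    B * gramDefect B Y * Bᵀ = Y - Y * (Y + B * Bᵀ)⁻¹ * Y := by
  have hdet : IsUnit (Y + B * Bᵀ).det := (isUnit_iff_isUnit_det _).1 hS.isUnit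
  set S := Y + B * Bᵀ with hSdef
  have h1 : S * S⁻¹ = 1 := mul_nonsing_inv _ hdet
  have h2 : S⁻¹ * S = 1 := nonsing_inv_mul _ hdet
  have hY : Y = S - B * Bᵀ := by rw [hSdef]; abel
  have h3 : Y * S⁻¹ * Y = S * S⁻¹ * S - S * S⁻¹ * (B * Bᵀ) - B * Bᵀ * (S⁻¹ * S)
      + B * Bᵀ * S⁻¹ * (B * Bᵀ) := by
    rw [hY]
    noncomm_ring
  rw [h3, h1, h2, mul_gramDefect_mul_eq_sub, ← hSdef, Matrix.one_mul, Matrix.one_mul,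
    Matrix.mul_one, Matrix.mul_assoc (B * Bᵀ), hY]
  abel

theorem dotProduct_mul_inv_mul_mulVec_nonneg (hY : Y.IsSymm) (hS : (Y + B * Bᵀ).PosDef)
    (v : ι → ℝ) :
    0 ≤ v ⬝ᵥ (Y * (Y + B * Bᵀ)⁻¹ * Y) *ᵥ v ∧
      (v ⬝ᵥ (Y * (Y + B * Bᵀ)⁻¹ * Y) *ᵥ v = 0 → Y *ᵥ v = 0) := by
  have h : v ⬝ᵥ (Y * (Y + B * Bᵀ)⁻¹ * Y) *ᵥ v = (Y *ᵥ v) ⬝ᵥ (Y + B * Bᵀ)⁻¹ *ᵥ (Y *ᵥ v) := by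
    rw [← mulVec_mulVec, ← mulVec_mulVec, dotProduct_mulVec v Y, ← mulVec_transpose, hY.eq]
  rw [h]
  refine ⟨by simpa using hS.inv.posSemidef.dotProduct_mulVec_nonneg (Y *ᵥ v), fun h0 => ?_⟩
  by_contra hne
  have := hS.inv.dotProduct_mulVec_pos hne
  rw [star_trivial] at this
  exact this.ne' h0

theorem trace_mul_gramDefect_mul_le [DecidableEq κ] (hY : Y.IsSymm) (hS : (Y + B * Bᵀ).PosDef)
    {A : Set (ι → ℝ)} {W : Matrix ι ι ℝ} (hW : W ∈ rankOneSums A) :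
    (B * gramDefect B Y * Bᵀ * W).trace ≤ (Y * W).trace := by
  rw [mul_gramDefect_mul hS, sub_mul, trace_sub]
  have := trace_mul_nonneg_of_mem_rankOneSums
    (fun v _ => (dotProduct_mul_inv_mul_mulVec_nonneg hY hS v).1) hW
  linarith

/-- If the parallel sum vanishes then `Y = Y S⁻¹ Y` is positive semidefinite, so that complementary
completely positive matrices are annihilated by `Y`. -/
theorem mul_eq_zero_of_gramDefect_eq_zero [DecidableEq κ] (hY : Y.IsSymm)
    (hS : (Y + B * Bᵀ).PosDef)
    (h0 : gramDefect B Y = 0) {A : Set (ι → ℝ)} {W : Matrix ι ι ℝ} (hW : W ∈ rankOneSums A)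
    (htr : (Y * W).trace = 0) : Y * W = 0 := by
  have hYY : Y = Y * (Y + B * Bᵀ)⁻¹ * Y := by
    have := mul_gramDefect_mul hS
    rw [h0, Matrix.mul_zero, Matrix.zero_mul] at this
    exact sub_eq_zero.1 this.symm
  have hv := dotProduct_mul_inv_mul_mulVec_nonneg hY hS
  rw [← hYY] at hv
  refine rankOneSums_induction (motive := fun W => Y * W = 0) (fun v hv' => ?_) (mul_zero _)
    (fun V W hV hW => by rw [mul_add, hV, hW, add_zero])
    (mem_rankOneSums_zeros (fun v _ => (hv v).1) hW htr)
  rw [mul_vecMulVec, (hv v).2 hv'.2, zero_vecMulVec]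

/-- The parallel sum at `l` is the infimum of `a · Y a + |Bᵀ (l - a)|²`; the vector `a` below is the
minimizer. -/
theorem dotProduct_mulVec_le_gramDefect [DecidableEq κ] (hS : (Y + B * Bᵀ).PosDef) (l : ι → ℝ) :
    (((Y + B * Bᵀ)⁻¹ * (B * Bᵀ)) *ᵥ l) ⬝ᵥ Y *ᵥ (((Y + B * Bᵀ)⁻¹ * (B * Bᵀ)) *ᵥ l) ≤
      l ⬝ᵥ (B * gramDefect B Y * Bᵀ) *ᵥ l := by
  have hdet : IsUnit (Y + B * Bᵀ).det := (isUnit_iff_isUnit_det _).1 hS.isUnit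
  set S := Y + B * Bᵀ with hSdef
  set a := (S⁻¹ * (B * Bᵀ)) *ᵥ l with ha
  have h1 : S *ᵥ a = (B * Bᵀ) *ᵥ l := by
    rw [ha, mulVec_mulVec, ← Matrix.mul_assoc, mul_nonsing_inv _ hdet, Matrix.one_mul]
  have h2 : Y *ᵥ a = (B * Bᵀ) *ᵥ (l - a) := by
    rw [mulVec_sub, ← h1, hSdef, add_mulVec, add_sub_cancel_right]
  have h3 : (B * gramDefect B Y * Bᵀ) *ᵥ l = (B * Bᵀ) *ᵥ (l - a) := by
    rw [mul_gramDefect_mul_eq_sub, ← hSdef, sub_mulVec, ← mulVec_mulVec _ (B * Bᵀ), ← ha, mulVec_sub]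
  have h4 : 0 ≤ (l - a) ⬝ᵥ (B * Bᵀ) *ᵥ (l - a) := by
    rw [← mulVec_mulVec, dotProduct_mulVec, ← mulVec_transpose]
    exact Finset.sum_nonneg fun _ _ => mul_self_nonneg _
  rw [h2, h3]
  rw [sub_dotProduct] at h4
  linarith

end ParallelSum

/-! ### Stability of complementarity on one face -/

section Local

open scoped Matrix.Norms.Elementwise

variable {ι κ : Type*} [Fintype ι] [DecidableEq ι] [Fintype κ] [DecidableEq κ]

/-- A quadratic form that is nonnegative on the nonnegative vectors of the range of `B`, and
nonpositive against a point of the cone they generate that dominates a positive multiple of every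
pair matrix of columns, vanishes on that range. -/
theorem transpose_mul_mul_eq_zero_of_trace_nonpos {V' Q : Matrix ι ι ℝ} {B : Matrix ι κ ℝ}
    (hBnn : ∀ i j, 0 ≤ B i j) (hQ : Q.IsSymm) {δ : ℝ} (hδ : 0 < δ)
    (hV' : V' ∈ rankOneSums {v | (∀ k, 0 ≤ v k) ∧ ∃ x, v = B *ᵥ x})
    (hQnn : ∀ x, (∀ k, 0 ≤ (B *ᵥ x) k) → 0 ≤ (B *ᵥ x) ⬝ᵥ Q *ᵥ (B *ᵥ x))
    (htr : (Q * (V' + δ • ∑ i, ∑ j, vecMulVec (B.col i + B.col j) (B.col i + B.col j))).trace ≤ 0) :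
    Bᵀ * Q * B = 0 := by
  have hV'nn : 0 ≤ (Q * V').trace := by
    refine trace_mul_nonneg_of_mem_rankOneSums ?_ hV'
    rintro _ ⟨hv, x, rfl⟩
    exact hQnn x hv
  have hpair : ∀ i j, 0 ≤ (B.col i + B.col j) ⬝ᵥ Q *ᵥ (B.col i + B.col j) := by
    intro i j
    have h : B.col i + B.col j = B *ᵥ (Pi.single i 1 + Pi.single j 1) := by
      rw [mulVec_add, mulVec_single_one, mulVec_single_one]
    rw [h]
    refine hQnn _ fun k => ?_
    rw [← h]
    exact add_nonneg (hBnn k i) (hBnn k j)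
  have hsum : ∑ i, ∑ j, (B.col i + B.col j) ⬝ᵥ Q *ᵥ (B.col i + B.col j) = 0 := by
    rw [mul_add, trace_add, Matrix.mul_smul, trace_smul, Finset.mul_sum, trace_sum] at htr
    simp only [Finset.mul_sum, trace_sum, trace_mul_vecMulVec_self, smul_eq_mul] at htr
    simp only [← Finset.mul_sum] at htr
    refine le_antisymm ?_ (Finset.sum_nonneg fun i _ => Finset.sum_nonneg fun j _ => hpair i j)
    by_contra! hlt
    nlinarith [mul_pos hδ hlt]
  have hzero : ∀ i j, (B.col i + B.col j) ⬝ᵥ Q *ᵥ (B.col i + B.col j) = 0 := fun i j =>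
    (Finset.sum_eq_zero_iff_of_nonneg
      (f := fun j => (B.col i + B.col j) ⬝ᵥ Q *ᵥ (B.col i + B.col j)) fun j _ => hpair i j).1
      ((Finset.sum_eq_zero_iff_of_nonneg
        (f := fun i => ∑ j, (B.col i + B.col j) ⬝ᵥ Q *ᵥ (B.col i + B.col j))
        fun i _ => Finset.sum_nonneg fun j _ => hpair i j).1 hsum i (Finset.mem_univ i))
      j (Finset.mem_univ j)
  have hcomm : ∀ i j, B.col j ⬝ᵥ Q *ᵥ B.col i = B.col i ⬝ᵥ Q *ᵥ B.col j := fun i j => by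
    rw [dotProduct_mulVec, ← mulVec_transpose, hQ.eq, dotProduct_comm]
  ext i j
  have h1 := hzero i j
  have h2 := hzero i i
  have h3 := hzero j j
  simp only [mulVec_add, add_dotProduct, dotProduct_add, hcomm i j] at h1 h2 h3
  have : (Bᵀ * Q * B) i j = B.col i ⬝ᵥ Q *ᵥ B.col j := by
    rw [Matrix.mul_assoc, mul_apply_eq_vecMul]
    rfl
  rw [this, Matrix.zero_apply]
  linarith

/-- Let `Y₀` be positive semidefinite with kernel the range of `B`, where the columns of `B` are
nonnegative, linearly independent, and span a positive vector. Let `V` be the sum of `V'`, in the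
cone of completely positive matrices complementary to `Y₀`, and a positive multiple of the pair
matrices of the columns. Then complementary copositive and completely positive pairs near `(Y₀, V)`
have product zero.

Otherwise the parallel sums of the copositive matrices with `B Bᵀ`, after normalization, would have
a nonzero limit. This limit is nonnegative on the nonnegative vectors of the kernel and nonpositive
against `V`, hence zero. -/
theorem eventually_mul_eq_zero_of_trace_eq_zero {Y₀ V' : Matrix ι ι ℝ} {B : Matrix ι κ ℝ}
    (hY₀ : Y₀.PosSemidef) (hYB : Y₀ * B = 0)
    (hker : ∀ u, Y₀ *ᵥ u = 0 → Bᵀ *ᵥ u = 0 → u = 0) (hB : ∀ x, B *ᵥ x = 0 → x = 0)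
    (hBnn : ∀ i j, 0 ≤ B i j) {e : κ → ℝ} (he : ∀ i, 0 < (B *ᵥ e) i)
    {δ : ℝ} (hδ : 0 < δ) (hV' : V' ∈ rankOneSums {v | (∀ k, 0 ≤ v k) ∧ ∃ x, v = B *ᵥ x}) :
    ∀ᶠ q : Matrix ι ι ℝ × Matrix ι ι ℝ in 𝓝 (Y₀, V' + δ • ∑ i, ∑ j,
        vecMulVec (B.col i + B.col j) (B.col i + B.col j)),
      q.1.IsSymm → (∀ v : ι → ℝ, (∀ k, 0 ≤ v k) → 0 ≤ v ⬝ᵥ q.1 *ᵥ v) →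
      q.2 ∈ rankOneSums {v | ∀ k, 0 ≤ v k} → (q.1 * q.2).trace = 0 → q.1 * q.2 = 0 := by
  set V := V' + δ • ∑ i, ∑ j, vecMulVec (B.col i + B.col j) (B.col i + B.col j) with hV
  by_contra hcon
  obtain ⟨F, hF⟩ := exists_ultrafilter_iff.2
    (frequently_iff_neBot.1 (not_eventually.1 hcon))
  have hFn : (F : Filter _) ≤ 𝓝 (Y₀, V) := hF.trans inf_le_left
  have hFbad := hF.trans inf_le_right (mem_principal_self _)
  have hbad : ∀ᶠ q : Matrix ι ι ℝ × Matrix ι ι ℝ in F, q.1.IsSymm ∧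
      (∀ v : ι → ℝ, (∀ k, 0 ≤ v k) → 0 ≤ v ⬝ᵥ q.1 *ᵥ v) ∧
      q.2 ∈ rankOneSums {v | ∀ k, 0 ≤ v k} ∧ (q.1 * q.2).trace = 0 ∧ q.1 * q.2 ≠ 0 := by
    filter_upwards [hFbad] with q hq
    simpa only [Set.mem_ofPred_eq, Classical.not_imp] using hq
  have hY : Tendsto (fun q : Matrix ι ι ℝ × Matrix ι ι ℝ => q.1) F (𝓝 Y₀) :=
    (continuous_fst.tendsto (Y₀, V)).mono_left hFn
  have hW : Tendsto (fun q : Matrix ι ι ℝ × Matrix ι ι ℝ => q.2) F (𝓝 V) :=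
    (continuous_snd.tendsto (Y₀, V)).mono_left hFn
  have hS₀ : (Y₀ + B * Bᵀ).PosDef := by
    have hBB := posSemidef_self_mul_conjTranspose B
    rw [conjTranspose_eq_transpose_of_trivial] at hBB
    refine PosDef.of_dotProduct_mulVec_pos (hY₀.add hBB).1 fun u hu => ?_
    have h1 := hY₀.dotProduct_mulVec_nonneg u
    have h2 := hBB.dotProduct_mulVec_nonneg u
    rw [add_mulVec, dotProduct_add]
    refine lt_of_le_of_ne (add_nonneg h1 h2) fun h => hu ?_
    refine hker u ((hY₀.dotProduct_mulVec_zero_iff u).1 (by linarith)) ?_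
    have h3 : (Bᵀ *ᵥ u) ⬝ᵥ (Bᵀ *ᵥ u) = 0 := by
      have : star u ⬝ᵥ (B * Bᵀ) *ᵥ u = 0 := by linarith
      rwa [star_trivial, ← mulVec_mulVec, dotProduct_mulVec, ← mulVec_transpose] at this
    exact dotProduct_self_eq_zero.1 h3
  have hS : Tendsto (fun q : Matrix ι ι ℝ × Matrix ι ι ℝ => q.1 + B * Bᵀ) F
      (𝓝 (Y₀ + B * Bᵀ)) := hY.add_const _
  have hG := (tendsto_inv_of_posDef hS₀).comp hS
  have hpd : ∀ᶠ q : Matrix ι ι ℝ × Matrix ι ι ℝ in F, (q.1 + B * Bᵀ).PosDef := by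
    filter_upwards [hbad, hS.eventually (eventually_posDef hS₀)] with q hq hq'
    exact hq' (hq.1.add (by rw [Matrix.IsSymm, transpose_mul, transpose_transpose]))
  -- For `l` in the kernel of `Y₀` the minimizer in the parallel sum tends to `l`.
  have hmin : ∀ x, Tendsto (fun q : Matrix ι ι ℝ × Matrix ι ι ℝ =>
      ((q.1 + B * Bᵀ)⁻¹ * (B * Bᵀ)) *ᵥ (B *ᵥ x)) F (𝓝 (B *ᵥ x)) := by
    intro x
    have h1 : (Y₀ + B * Bᵀ)⁻¹ * (B * Bᵀ) * B = B := by
      have : B * Bᵀ * B = (Y₀ + B * Bᵀ) * B := by rw [Matrix.add_mul, hYB, zero_add]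
      rw [Matrix.mul_assoc, this, ← Matrix.mul_assoc,
        nonsing_inv_mul _ ((isUnit_iff_isUnit_det _).1 hS₀.isUnit), Matrix.one_mul]
    have hc : Continuous fun T : Matrix ι ι ℝ => (T * (B * Bᵀ)) *ᵥ (B *ᵥ x) :=
      (continuous_id.matrix_mul continuous_const).matrix_mulVec continuous_const
    have := (hc.tendsto _).comp hG
    rwa [mulVec_mulVec, h1] at this
  let N : Matrix ι ι ℝ × Matrix ι ι ℝ → Matrix κ κ ℝ :=
    fun q => ‖gramDefect B q.1‖⁻¹ • gramDefect B q.1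
  have hN : ∀ᶠ q in F, N q ∈ Metric.sphere (0 : Matrix κ κ ℝ) 1 := by
    filter_upwards [hbad, hpd] with q ⟨h1, _, h3, h4, h5⟩ hq
    have hne : gramDefect B q.1 ≠ 0 := fun h =>
      h5 (mul_eq_zero_of_gramDefect_eq_zero h1 hq h h3 h4)
    simp [N, norm_smul, norm_ne_zero_iff.2 hne]
  have : ProperSpace (Matrix κ κ ℝ) := FiniteDimensional.proper ℝ _
  obtain ⟨Q, hQ1, hQ⟩ := (isCompact_sphere (0 : Matrix κ κ ℝ) 1).ultrafilter_le_nhds'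
    (F.map N) hN
  have hQ : Tendsto N F (𝓝 Q) := hQ
  have hBN : ∀ q, B * N q * Bᵀ = ‖gramDefect B q.1‖⁻¹ • (B * gramDefect B q.1 * Bᵀ) := by
    intro q
    simp only [N, Matrix.mul_smul, Matrix.smul_mul]
  have hBQ : Tendsto (fun q => B * N q * Bᵀ) F (𝓝 (B * Q * Bᵀ)) := by
    have hc : Continuous fun T : Matrix κ κ ℝ => B * T * Bᵀ :=
      (continuous_const.matrix_mul continuous_id).matrix_mul continuous_const
    exact (hc.tendsto Q).comp hQ
  have hQsymm : (B * Q * Bᵀ).IsSymm := by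
    have hc : Continuous fun T : Matrix ι ι ℝ => Tᵀ := continuous_id.matrix_transpose
    refine tendsto_nhds_unique ((hc.tendsto _).comp hBQ) (hBQ.congr' ?_)
    filter_upwards [hbad, hpd] with q hq hq'
    have hsymm : (q.1 + B * Bᵀ)ᵀ = q.1 + B * Bᵀ := by
      rw [transpose_add, hq.1.eq, transpose_mul, transpose_transpose]
    rw [Function.comp_apply, hBN, transpose_smul, mul_gramDefect_mul hq', transpose_sub,
      transpose_mul, transpose_mul, transpose_nonsing_inv, hsymm, hq.1.eq, Matrix.mul_assoc]
  have htr : (B * Q * Bᵀ * V).trace ≤ 0 := by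
    have hc : Continuous fun q : Matrix ι ι ℝ × Matrix ι ι ℝ => (q.1 * q.2).trace :=
      (continuous_fst.matrix_mul continuous_snd).matrix_trace
    refine le_of_tendsto ((hc.tendsto (B * Q * Bᵀ, V)).comp (hBQ.prodMk_nhds hW)) ?_
    filter_upwards [hbad, hpd] with q hq hq'
    rw [Function.comp_apply]
    dsimp only
    rw [hBN, Matrix.smul_mul, trace_smul, smul_eq_mul]
    refine mul_nonpos_of_nonneg_of_nonpos (inv_nonneg.2 (norm_nonneg _)) ?_
    exact (trace_mul_gramDefect_mul_le hq.1 hq' hq.2.2.1).trans hq.2.2.2.1.le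
  have hpos : ∀ x, (∀ k, 0 < (B *ᵥ x) k) →
      0 ≤ (B *ᵥ x) ⬝ᵥ (B * Q * Bᵀ) *ᵥ (B *ᵥ x) := by
    intro x hx
    refine ge_of_tendsto (tendsto_dotProduct_mulVec hBQ tendsto_const_nhds) ?_
    have hmin' : ∀ᶠ q : Matrix ι ι ℝ × Matrix ι ι ℝ in F, ∀ k,
        0 < (((q.1 + B * Bᵀ)⁻¹ * (B * Bᵀ)) *ᵥ (B *ᵥ x)) k :=
      eventually_all.2 fun k => ((tendsto_pi_nhds.1 (hmin x)) k).eventually (lt_mem_nhds (hx k))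
    filter_upwards [hbad, hpd, hmin'] with q hq hq' hqx
    rw [hBN, smul_mulVec, dotProduct_smul, smul_eq_mul]
    refine mul_nonneg (inv_nonneg.2 (norm_nonneg _)) ?_
    exact (hq.2.1 _ fun k => (hqx k).le).trans (dotProduct_mulVec_le_gramDefect hq' _)
  have hnonneg : ∀ x, (∀ k, 0 ≤ (B *ᵥ x) k) →
      0 ≤ (B *ᵥ x) ⬝ᵥ (B * Q * Bᵀ) *ᵥ (B *ᵥ x) := by
    intro x hx
    have hlim : Tendsto (fun η : ℝ => B *ᵥ (x + η • e)) (𝓝[>] 0) (𝓝 (B *ᵥ x)) := by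
      have hc : Continuous fun η : ℝ => B *ᵥ (x + η • e) :=
        continuous_const.matrix_mulVec (by fun_prop)
      have := hc.tendsto 0
      rw [zero_smul, add_zero] at this
      exact this.mono_left nhdsWithin_le_nhds
    refine ge_of_tendsto (tendsto_dotProduct_mulVec tendsto_const_nhds hlim) ?_
    filter_upwards [self_mem_nhdsWithin] with η hη
    refine hpos _ fun k => ?_
    rw [mulVec_add, mulVec_smul]
    exact add_pos_of_nonneg_of_pos (hx k) (mul_pos hη (he k))
  have hzero := transpose_mul_mul_eq_zero_of_trace_nonpos hBnn hQsymm hδ hV' hnonneg htr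
  -- The Gram matrix `Bᵀ B` is invertible and can be cancelled on both sides.
  have hgram : IsUnit (Bᵀ * B) := by
    rw [← mulVec_injective_iff_isUnit]
    refine (injective_iff_map_eq_zero (Bᵀ * B).mulVecLin).2 fun x hx => hB x ?_
    have hx : (Bᵀ * B) *ᵥ x = 0 := hx
    have h1 : (B *ᵥ x) ⬝ᵥ (B *ᵥ x) = 0 := by
      rw [dotProduct_comm, dotProduct_mulVec, ← mulVec_transpose, mulVec_mulVec, hx, zero_dotProduct]
    exact dotProduct_self_eq_zero.1 h1
  have hQ0 : Q = 0 := by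
    have h1 : Bᵀ * B * (Q * (Bᵀ * B)) = 0 := by
      rw [← hzero]
      simp only [Matrix.mul_assoc]
    exact hgram.mul_left_eq_zero.1 (hgram.mul_right_eq_zero.1 h1)
  simp [hQ0] at hQ1

end Local

/-! ### Zeros of copositive forms -/

section Zeros

variable {p : ℕ} {X : Matrix (Fin p) (Fin p) ℝ}

theorem Matrix.IsSymm.dotProduct_mulVec_comm {ι : Type*} [Fintype ι] {X : Matrix ι ι ℝ}
    (hX : X.IsSymm) (u v : ι → ℝ) : u ⬝ᵥ X *ᵥ v = v ⬝ᵥ X *ᵥ u := by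
  rw [dotProduct_mulVec, ← mulVec_transpose, hX.eq, dotProduct_comm]

/-- At a zero of a copositive form the gradient is nonnegative. -/
theorem mulVec_nonneg_of_zero (hX : X ∈ copositiveCone p) {t : Fin p → ℝ} (ht : ∀ k, 0 ≤ t k)
    (h0 : t ⬝ᵥ X *ᵥ t = 0) (k : Fin p) : 0 ≤ (X *ᵥ t) k := by
  have key : ∀ η : ℝ, 0 < η → 0 ≤ 2 * (X *ᵥ t) k + η * X k k := by
    intro η hη
    have h := hX.2 (t + η • Pi.single k 1) fun i => by
      refine add_nonneg (ht i) (mul_nonneg hη.le ?_)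
      by_cases hik : i = k
      · subst hik; simp
      · simp [hik]
    have h1 : Pi.single k (1 : ℝ) ⬝ᵥ X *ᵥ t = (X *ᵥ t) k := by simp
    have h2 : Pi.single k (1 : ℝ) ⬝ᵥ X *ᵥ Pi.single k (1 : ℝ) = X k k := by simp
    rw [mulVec_add, mulVec_smul, add_dotProduct, dotProduct_add, dotProduct_add, smul_dotProduct,
      smul_dotProduct, dotProduct_smul, dotProduct_smul, hX.1.dotProduct_mulVec_comm t (Pi.single k 1),
      h0, h1, h2, smul_eq_mul, smul_eq_mul, smul_eq_mul] at h
    have h3 : 0 ≤ η * (2 * (X *ᵥ t) k + η * X k k) := by linarith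
    exact nonneg_of_mul_nonneg_right h3 hη
  have hlim : Tendsto (fun η : ℝ => 2 * (X *ᵥ t) k + η * X k k) (𝓝[>] 0)
      (𝓝 (2 * (X *ᵥ t) k + 0 * X k k)) :=
    ((continuous_const.add (continuous_id.mul continuous_const)).tendsto 0).mono_left
      nhdsWithin_le_nhds
  have := ge_of_tendsto hlim (by filter_upwards [self_mem_nhdsWithin] with η hη using key η hη)
  linarith

theorem mulVec_eq_zero_of_ne_zero (hX : X ∈ copositiveCone p) {t : Fin p → ℝ}
    (ht : ∀ k, 0 ≤ t k) (h0 : t ⬝ᵥ X *ᵥ t = 0) {k : Fin p} (hk : t k ≠ 0) : (X *ᵥ t) k = 0 := by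
  have := (Finset.sum_eq_zero_iff_of_nonneg (f := fun k => t k * (X *ᵥ t) k)
    fun k _ => mul_nonneg (ht k) (mulVec_nonneg_of_zero hX ht h0 k)).1 h0 k (Finset.mem_univ k)
  exact (mul_eq_zero.1 this).resolve_left hk

theorem isCompact_normalizedZeros : IsCompact (normalizedZeros X) := by
  have hc : Continuous fun t : Fin p → ℝ => t ⬝ᵥ X *ᵥ t :=
    continuous_id.dotProduct (continuous_const.matrix_mulVec continuous_id)
  exact (isCompact_stdSimplex ℝ (Fin p)).inter_right (isClosed_singleton.preimage hc)

theorem zeroVertices_subset : zeroVertices X ⊆ normalizedZeros X := extremePoints_convexHull_subset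

/-- Two vertices with the same support coincide: the form vanishes on the line through them, and
the line can be extended beyond both points within the simplex. -/
theorem eq_of_support_eq (hX : X ∈ copositiveCone p) {σ τ : Fin p → ℝ} (hσ : σ ∈ zeroVertices X)
    (hτ : τ ∈ zeroVertices X) (h : Function.support σ = Function.support τ) : σ = τ := by
  have hσ' := zeroVertices_subset hσ
  have hτ' := zeroVertices_subset hτ
  have hcross : σ ⬝ᵥ X *ᵥ τ = 0 := by
    refine Finset.sum_eq_zero fun k _ => ?_
    by_cases hk : σ k = 0
    · simp [hk]
    · have : τ k ≠ 0 := by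
        have : k ∈ Function.support τ := h ▸ hk
        exact this
      rw [mulVec_eq_zero_of_ne_zero hX hτ'.1.1 hτ'.2 this, mul_zero]
  have hline : ∀ η : ℝ, (∀ k, 0 ≤ (τ + η • (σ - τ)) k) → τ + η • (σ - τ) ∈ normalizedZeros X := by
    intro η hη
    refine ⟨⟨hη, ?_⟩, ?_⟩
    · simp only [Pi.add_apply, Pi.smul_apply, Pi.sub_apply, smul_eq_mul, Finset.sum_add_distrib,
        ← Finset.mul_sum, Finset.sum_sub_distrib]
      rw [hσ'.1.2, hτ'.1.2]
      ring
    · simp only [mulVec_add, mulVec_smul, mulVec_sub, dotProduct_add, dotProduct_smul,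
        dotProduct_sub, add_dotProduct, smul_dotProduct, sub_dotProduct, hσ'.2, hτ'.2, hcross,
        hX.1.dotProduct_mulVec_comm τ σ]
      simp
  have hsmall : ∀ᶠ η : ℝ in 𝓝 0, ∀ k, 0 ≤ (τ + η • (σ - τ)) k := by
    refine eventually_all.2 fun k => ?_
    by_cases hk : τ k = 0
    · have : σ k = 0 := by
        by_contra h'
        have : k ∈ Function.support τ := h ▸ h'
        exact this hk
      simp [hk, this]
    · have hpos : 0 < τ k := lt_of_le_of_ne (hτ'.1.1 k) (Ne.symm hk)
      have hc : Continuous fun η : ℝ => (τ + η • (σ - τ)) k := by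
        simp only [Pi.add_apply, Pi.smul_apply, smul_eq_mul]
        fun_prop
      have := hc.tendsto 0
      simp only [zero_smul, add_zero] at this
      exact (this.eventually (lt_mem_nhds hpos)).mono fun η hη => hη.le
  obtain ⟨r, hr, hball⟩ := Metric.eventually_nhds_iff.1 hsmall
  have hmem := hline (-(r / 2)) (hball (by
    rw [Real.dist_eq, sub_zero, abs_neg, abs_of_pos (by linarith)]
    linarith))
  -- `τ` lies in the open segment between `σ` and the extension beyond `τ`.
  refine (mem_extremePoints_iff_left.1 hτ).2 σ (subset_convexHull ℝ _ hσ') _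
    (subset_convexHull ℝ _ hmem) ?_
  refine ⟨(r / 2) / (1 + r / 2), 1 / (1 + r / 2), by positivity, by positivity,
    by field_simp; ring, ?_⟩
  ext k
  simp only [Pi.add_apply, Pi.smul_apply, Pi.sub_apply, smul_eq_mul]
  field_simp
  ring

theorem finite_zeroVertices (hX : X ∈ copositiveCone p) : (zeroVertices X).Finite :=
  Set.Finite.of_finite_image (f := Function.support) (Set.toFinite _)
    fun _ hσ _ hτ h => eq_of_support_eq hX hσ hτ h

/-- Every normalized zero is a convex combination of vertices. -/
theorem normalizedZeros_subset_convexHull (hX : X ∈ copositiveCone p) :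
    normalizedZeros X ⊆ convexHull ℝ (zeroVertices X) := by
  have h : closure (convexHull ℝ (zeroVertices X)) = convexHull ℝ (normalizedZeros X) :=
    closure_convexHull_extremePoints
    (isCompact_convexHull_of_finiteDimensional (isCompact_normalizedZeros (X := X)))
    (convex_convexHull ℝ _)
  rw [((finite_zeroVertices hX).isClosed_convexHull ℝ).closure_eq] at h
  rw [h]
  exact subset_convexHull ℝ _

end Zeros

/-! ### The faces attached to the parts of the vertex set -/

section Faces

variable {p m : ℕ} {X : Matrix (Fin p) (Fin p) ℝ} {J : Fin m → Set (Fin p → ℝ)}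

theorem mem_supportIndices {I : Set (Fin p → ℝ)} {k : Fin p} :
    k ∈ supportIndices I ↔ ∃ τ ∈ I, k ∈ Function.support τ := by
  simp [supportIndices]

theorem support_subset_supportIndices {I : Set (Fin p → ℝ)} {τ : Fin p → ℝ} (hτ : τ ∈ I) :
    Function.support τ ⊆ supportIndices I := fun _ hk =>
  mem_supportIndices.2 ⟨τ, hτ, hk⟩

/-- The nonnegative zeros of the form `X`, of any length, supported in the index set `P`. -/
def supportedZeros (X : Matrix (Fin p) (Fin p) ℝ) (P : Finset (Fin p)) : Set (Fin p → ℝ) :=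
  {v | (∀ k, 0 ≤ v k) ∧ Function.support v ⊆ P ∧ v ⬝ᵥ X *ᵥ v = 0}

theorem IsVertexPartition.subset (hJ : IsVertexPartition X m J) (s : Fin m) :
    J s ⊆ zeroVertices X := hJ.cover ▸ Set.subset_iUnion J s

/-- When all `M(j)`, `j ∈ J(s)`, equal `P_*(s)`, a vertex supported in `P_*(s)` belongs to `J(s)`;
otherwise it would be separated from some vertex of `J(s)`. -/
theorem IsVertexPartition.mem_of_support_subset (hJ : IsVertexPartition X m J)
    (hM : ∀ s, ∀ τ ∈ J s, zeroIndices X τ = (supportIndices (J s) : Set (Fin p)))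
    {τ : Fin p → ℝ} (hτ : τ ∈ zeroVertices X) {s : Fin m}
    (h : Function.support τ ⊆ supportIndices (J s)) : τ ∈ J s := by
  by_contra hnot
  rw [← hJ.cover] at hτ
  obtain ⟨s', hs'⟩ := Set.mem_iUnion.1 hτ
  have hne : s' ≠ s := by
    rintro rfl
    exact hnot hs'
  obtain ⟨j, hj, k, hk, hkj⟩ := (hJ.separated s' s hne).2.2 τ ⟨hs', hnot⟩
  rw [hM s j hj.1] at hkj
  exact hkj (h hk)

/-- A nonzero nonnegative zero of the form is a positive combination of vertices of one part. -/
theorem IsVertexPartition.exists_part (hX : X ∈ copositiveCone p)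
    (hJ : IsVertexPartition X m J)
    (hM : ∀ s, ∀ τ ∈ J s, zeroIndices X τ = (supportIndices (J s) : Set (Fin p)))
    {v : Fin p → ℝ} (hv : ∀ k, 0 ≤ v k) (h0 : v ⬝ᵥ X *ᵥ v = 0) (hne : v ≠ 0) :
    ∃ s, Function.support v ⊆ supportIndices (J s) ∧
      (∀ k ∉ supportIndices (J s), 0 < (X *ᵥ v) k) ∧
      ∀ s', Function.support v ⊆ supportIndices (J s') → v ∈ Submodule.span ℝ (J s') := by
  have hsum : 0 < ∑ k, v k := by
    refine lt_of_le_of_ne (Finset.sum_nonneg fun k _ => hv k) fun h => hne ?_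
    ext k
    exact (Finset.sum_eq_zero_iff_of_nonneg fun k _ => hv k).1 h.symm k (Finset.mem_univ k)
  set c := ∑ k, v k with hc
  have hmem : c⁻¹ • v ∈ normalizedZeros X := by
    refine ⟨⟨fun k => mul_nonneg (inv_nonneg.2 hsum.le) (hv k), ?_⟩, ?_⟩
    · simp only [Pi.smul_apply, smul_eq_mul]
      rw [← Finset.mul_sum, ← hc, inv_mul_cancel₀ hsum.ne']
    · rw [mulVec_smul, smul_dotProduct, dotProduct_smul, h0, smul_zero, smul_zero]
  obtain ⟨κ, _, w, z, hw, hw1, hz, hwz⟩ :=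
    mem_convexHull_iff_exists_fintype.1 (normalizedZeros_subset_convexHull hX hmem)
  have hvz : v = ∑ i, (c * w i) • z i := by
    have : v = c • c⁻¹ • v := by rw [smul_smul, mul_inv_cancel₀ hsum.ne', one_smul]
    rw [this, ← hwz, Finset.smul_sum]
    simp only [smul_smul]
  have hzX : ∀ i k, 0 ≤ (X *ᵥ z i) k := fun i k =>
    have h := zeroVertices_subset (hz i)
    mulVec_nonneg_of_zero hX h.1.1 h.2 k
  have hz0 : ∀ i k, 0 ≤ z i k := fun i k => (zeroVertices_subset (hz i)).1.1 k
  have hXv : ∀ k, (X *ᵥ v) k = ∑ i, (c * w i) * (X *ᵥ z i) k := by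
    intro k
    rw [hvz, mulVec_sum, Finset.sum_apply]
    simp only [mulVec_smul, Pi.smul_apply, smul_eq_mul]
  have hvk : ∀ k, v k = ∑ i, (c * w i) * z i k := by
    intro k
    conv_lhs => rw [hvz]
    rw [Finset.sum_apply]
    simp only [Pi.smul_apply, smul_eq_mul]
  have hterm : ∀ i, 0 ≤ c * w i := fun i => mul_nonneg hsum.le (hw i)
  have hsupp : ∀ i, w i ≠ 0 → Function.support (z i) ⊆ Function.support v := by
    intro i hi k hk hvk0
    rw [hvk] at hvk0
    have := (Finset.sum_eq_zero_iff_of_nonneg fun i _ => mul_nonneg (hterm i) (hz0 i k)).1 hvk0 i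
      (Finset.mem_univ i)
    rcases mul_eq_zero.1 this with h | h
    · exact (mul_ne_zero hsum.ne' hi) h
    · exact hk h
  have hindices : ∀ i, w i ≠ 0 → Function.support v ⊆ zeroIndices X (z i) := by
    intro i hi k hk
    have h1 := mulVec_eq_zero_of_ne_zero hX hv h0 hk
    rw [hXv] at h1
    have := (Finset.sum_eq_zero_iff_of_nonneg fun i _ => mul_nonneg (hterm i) (hzX i k)).1 h1 i
      (Finset.mem_univ i)
    exact (mul_eq_zero.1 this).resolve_left (mul_ne_zero hsum.ne' hi)
  have hpart : ∀ s', Function.support v ⊆ supportIndices (J s') → ∀ i, w i ≠ 0 → z i ∈ J s' :=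
    fun s' hs' i hi => hJ.mem_of_support_subset hM (hz i) ((hsupp i hi).trans hs')
  obtain ⟨i₀, hi₀⟩ : ∃ i, w i ≠ 0 := by
    by_contra! h
    simp [h] at hw1
  obtain ⟨s, hs⟩ : ∃ s, z i₀ ∈ J s := by
    have := hz i₀
    rw [← hJ.cover] at this
    exact Set.mem_iUnion.1 this
  have hvs : Function.support v ⊆ supportIndices (J s) := hM s _ hs ▸ hindices i₀ hi₀
  refine ⟨s, hvs, fun k hk => ?_, fun s' hs' => ?_⟩
  · rw [hXv]
    refine Finset.sum_pos' (fun i _ => mul_nonneg (hterm i) (hzX i k)) ⟨i₀, Finset.mem_univ _, ?_⟩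
    refine mul_pos (mul_pos hsum (lt_of_le_of_ne (hw _) hi₀.symm)) (lt_of_le_of_ne (hzX _ _) ?_)
    intro h
    have : k ∈ zeroIndices X (z i₀) := h.symm
    rw [hM s _ hs] at this
    exact hk this
  · rw [hvz]
    refine Submodule.sum_mem _ fun i _ => ?_
    by_cases hi : w i = 0
    · simp [hi]
    · exact Submodule.smul_mem _ _ (Submodule.subset_span (hpart s' hs' i hi))

theorem IsVertexPartition.mem_span_of_mem_supportedZeros (hX : X ∈ copositiveCone p)
    (hJ : IsVertexPartition X m J)
    (hM : ∀ s, ∀ τ ∈ J s, zeroIndices X τ = (supportIndices (J s) : Set (Fin p)))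
    {v : Fin p → ℝ} {s : Fin m} (hv : v ∈ supportedZeros X (supportIndices (J s))) :
    v ∈ Submodule.span ℝ (J s) := by
  by_cases h : v = 0
  · rw [h]
    exact zero_mem _
  · obtain ⟨_, _, _, h3⟩ := hJ.exists_part hX hM hv.1 hv.2.2 h
    exact h3 s hv.2.1

/-- The zeros of a copositive form near `X₀` are supported in one of the sets `P_*(s)`: near a zero
`t₀` of `X₀` in the face of `s`, the gradient is positive outside `P_*(s)`. -/
theorem IsVertexPartition.eventually_exists_support_subset {X₀ : Matrix (Fin p) (Fin p) ℝ}
    (hX₀ : X₀ ∈ copositiveCone p) (hJ : IsVertexPartition X₀ m J)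
    (hM : ∀ s, ∀ τ ∈ J s, zeroIndices X₀ τ = (supportIndices (J s) : Set (Fin p))) :
    ∀ᶠ X in 𝓝 X₀, X ∈ copositiveCone p → ∀ v : Fin p → ℝ, (∀ k, 0 ≤ v k) → v ⬝ᵥ X *ᵥ v = 0 →
      ∃ s, Function.support v ⊆ supportIndices (J s) := by
  have hquad : Continuous fun q : Matrix (Fin p) (Fin p) ℝ × (Fin p → ℝ) => q.2 ⬝ᵥ q.1 *ᵥ q.2 :=
    continuous_snd.dotProduct (continuous_fst.matrix_mulVec continuous_snd)
  have hgrad : ∀ k, Continuous fun q : Matrix (Fin p) (Fin p) ℝ × (Fin p → ℝ) => (q.1 *ᵥ q.2) k :=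
    fun k => (continuous_apply k).comp (continuous_fst.matrix_mulVec continuous_snd)
  have key := (isCompact_stdSimplex ℝ (Fin p)).eventually_forall_of_forall_eventually (x₀ := X₀)
    (P := fun X t => t ⬝ᵥ X *ᵥ t = 0 → ∃ s, ∀ k ∉ supportIndices (J s), 0 < (X *ᵥ t) k)
    fun t ht => by
      by_cases h0 : t ⬝ᵥ X₀ *ᵥ t = 0
      · have hne : t ≠ 0 := by
          rintro rfl
          simpa using ht.2
        obtain ⟨s, _, hs, _⟩ := hJ.exists_part hX₀ hM ht.1 h0 hne
        have : ∀ k ∈ (supportIndices (J s))ᶜ,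
            ∀ᶠ q : Matrix (Fin p) (Fin p) ℝ × (Fin p → ℝ) in 𝓝 (X₀, t), 0 < (q.1 *ᵥ q.2) k :=
          fun k hk => ((hgrad k).tendsto (X₀, t)).eventually
            (lt_mem_nhds (hs k (Finset.mem_compl.1 hk)))
        filter_upwards [(eventually_all_finset _).2 this] with q hq _
        exact ⟨s, fun k hk => hq k (Finset.mem_compl.2 hk)⟩
      · filter_upwards [(hquad.tendsto (X₀, t)).eventually_ne h0] with q hq h
        exact absurd h hq
  filter_upwards [key] with X hX hXc v hv h0
  rcases (Finset.sum_nonneg fun k _ => hv k).eq_or_lt with h | hpos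
  · have : v = 0 := by
      ext k
      exact (Finset.sum_eq_zero_iff_of_nonneg fun k _ => hv k).1 h.symm k (Finset.mem_univ k)
    exact ⟨⟨0, hJ.one_le⟩, by simp [this]⟩
  · obtain ⟨s, hs⟩ := hX ((∑ k, v k)⁻¹ • v)
      ⟨fun k => mul_nonneg (inv_nonneg.2 hpos.le) (hv k), by
        simp only [Pi.smul_apply, smul_eq_mul]
        rw [← Finset.mul_sum, inv_mul_cancel₀ hpos.ne']⟩
      (by rw [mulVec_smul, smul_dotProduct, dotProduct_smul, h0, smul_zero, smul_zero])
    refine ⟨s, fun k hk => ?_⟩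
    by_contra hks
    have := hs k hks
    rw [mulVec_smul, Pi.smul_apply, mulVec_eq_zero_of_ne_zero hXc hv h0 hk, smul_zero] at this
    exact lt_irrefl _ this

end Faces

/-! ### Relative interior points and uniqueness of the decomposition -/

/-- A relative interior point of a cone dominates a positive multiple of every element. -/
theorem exists_sub_smul_mem_of_mem_intrinsicInterior {E : Type*} [AddCommGroup E] [Module ℝ E]
    [TopologicalSpace E] [IsTopologicalAddGroup E] [ContinuousSMul ℝ E] {K : Set E}
    (hK : ∀ c : ℝ, 0 ≤ c → ∀ x ∈ K, c • x ∈ K) {u h : E}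
    (hu : u ∈ intrinsicInterior ℝ K) (hh : h ∈ K) : ∃ δ : ℝ, 0 < δ ∧ u - δ • h ∈ K := by
  have huK := intrinsicInterior_subset hu
  obtain ⟨y, hy, rfl⟩ := mem_intrinsicInterior.1 hu
  have hline : ∀ η : ℝ, AffineMap.lineMap (y : E) h (-η) ∈ affineSpan ℝ K := fun η =>
    AffineMap.lineMap_mem _ y.2 (subset_affineSpan ℝ K hh)
  have hcont : Continuous fun η : ℝ =>
      (⟨AffineMap.lineMap (y : E) h (-η), hline η⟩ : affineSpan ℝ K) := by
    refine Continuous.subtype_mk ?_ _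
    simp only [AffineMap.lineMap_apply_module']
    fun_prop
  have hev : ∀ᶠ η in 𝓝 (0 : ℝ), AffineMap.lineMap (y : E) h (-η) ∈ K := by
    have h0 : (⟨AffineMap.lineMap (y : E) h (-(0 : ℝ)), hline 0⟩ : affineSpan ℝ K) = y := by
      ext
      simp
    have := hcont.tendsto 0
    rw [h0] at this
    exact this.eventually (mem_interior_iff_mem_nhds.1 hy)
  obtain ⟨η, hηK, hη⟩ := ((hev.filter_mono nhdsWithin_le_nhds).and
    (self_mem_nhdsWithin (s := Set.Ioi (0 : ℝ)))).exists
  have hη : 0 < η := hη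
  refine ⟨η / (1 + η), by positivity, ?_⟩
  convert hK (1 + η)⁻¹ (by positivity) _ hηK using 1
  rw [AffineMap.lineMap_apply_module]
  have h1 : (1 + η)⁻¹ * (1 - -η) = 1 := by
    rw [sub_neg_eq_add, inv_mul_cancel₀ (by positivity)]
  rw [smul_add, smul_smul, smul_smul, h1, one_smul, sub_eq_add_neg, ← neg_smul]
  congr 2
  ring

/-- The spans of the blocks of a linearly independent family are independent. -/
theorem eq_zero_of_sum_eq_zero_of_mem_span {M σ : Type*} [AddCommGroup M] [Module ℝ M] [Fintype σ]
    {κ : σ → Type*} [∀ s, Finite (κ s)] {f : ∀ s, κ s → M}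
    (hf : LinearIndependent ℝ fun q : Σ s, κ s => f q.1 q.2) {D : σ → M}
    (hD : ∀ s, D s ∈ Submodule.span ℝ (Set.range (f s))) (hsum : ∑ s, D s = 0) (s : σ) :
    D s = 0 := by
  have := fun s => Fintype.ofFinite (κ s)
  choose c hc using fun s => (Submodule.mem_span_range_iff_exists_fun ℝ).1 (hD s)
  have h0 : ∀ q : Σ s, κ s, c q.1 q.2 = 0 := by
    refine Fintype.linearIndependent_iff.1 hf (fun q => c q.1 q.2) ?_
    rw [Fintype.sum_sigma, ← hsum]
    exact Finset.sum_congr rfl fun s _ => hc s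
  rw [← hc s]
  exact Finset.sum_eq_zero fun i _ => by rw [h0 ⟨s, i⟩, zero_smul]

section PairSpan

variable {p : ℕ} {I : Set (Fin p → ℝ)}

theorem vecMulVec_add_swap_mem_span_pairMatrix {v w : Fin p → ℝ} (hv : v ∈ Submodule.span ℝ I)
    (hw : w ∈ Submodule.span ℝ I) :
    vecMulVec v w + vecMulVec w v ∈ Submodule.span ℝ (Set.range (pairMatrix (I := I))) := by
  induction hv, hw using Submodule.span_induction₂ with
  | mem_mem x y hx hy =>
    have hpair : ∀ a ∈ I, ∀ b ∈ I, vecMulVec (a + b) (a + b) ∈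
        Submodule.span ℝ (Set.range (pairMatrix (I := I))) := fun a ha b hb =>
      Submodule.subset_span ⟨s(⟨a, ha⟩, ⟨b, hb⟩), rfl⟩
    have : vecMulVec x y + vecMulVec y x = vecMulVec (x + y) (x + y)
        - (1 / 4 : ℝ) • vecMulVec (x + x) (x + x) - (1 / 4 : ℝ) • vecMulVec (y + y) (y + y) := by
      ext i j
      simp only [Matrix.add_apply, Matrix.sub_apply, Matrix.smul_apply, vecMulVec_apply,
        Pi.add_apply, smul_eq_mul]
      ring
    rw [this]
    exact Submodule.sub_mem _ (Submodule.sub_mem _ (hpair x hx y hy)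
      (Submodule.smul_mem _ _ (hpair x hx x hx))) (Submodule.smul_mem _ _ (hpair y hy y hy))
  | zero_left => simp
  | zero_right => simp
  | add_left x y z _ _ _ h1 h2 =>
    rw [add_vecMulVec, vecMulVec_add, add_add_add_comm]
    exact add_mem h1 h2
  | add_right x y z _ _ _ h1 h2 =>
    rw [add_vecMulVec, vecMulVec_add, add_add_add_comm]
    exact add_mem h1 h2
  | smul_left r x y _ _ h =>
    rw [smul_vecMulVec, vecMulVec_smul, ← smul_add]
    exact Submodule.smul_mem _ _ h
  | smul_right r x y _ _ h =>
    rw [smul_vecMulVec, vecMulVec_smul, ← smul_add]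
    exact Submodule.smul_mem _ _ h

theorem mem_span_pairMatrix_of_mem_rankOneSums {A : Set (Fin p → ℝ)}
    (hA : ∀ v ∈ A, v ∈ Submodule.span ℝ I) {W : Matrix (Fin p) (Fin p) ℝ}
    (hW : W ∈ rankOneSums A) : W ∈ Submodule.span ℝ (Set.range (pairMatrix (I := I))) := by
  refine rankOneSums_induction
    (motive := fun W => W ∈ Submodule.span ℝ (Set.range (pairMatrix (I := I))))
    (fun v hv => ?_) (zero_mem _) (fun _ _ => add_mem) hW
  have h := Submodule.smul_mem _ (1 / 2 : ℝ)
    (vecMulVec_add_swap_mem_span_pairMatrix (hA v hv) (hA v hv))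
  rwa [← two_smul ℝ, smul_smul, show (1 / 2 : ℝ) * 2 = 1 by norm_num, one_smul] at h

end PairSpan

/-! ### Restriction to principal blocks -/

section Restriction

variable {p : ℕ} {P : Finset (Fin p)}

theorem sum_coe_eq_sum_of_support_subset {f : Fin p → ℝ} (h : ∀ k ∉ P, f k = 0) :
    ∑ k : P, f k = ∑ k, f k := by
  rw [Finset.sum_coe_sort P f]
  exact Finset.sum_subset (Finset.subset_univ P) fun k _ hk => h k hk

theorem restrictMatrix_mulVec (X : Matrix (Fin p) (Fin p) ℝ) {v : Fin p → ℝ}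
    (hv : Function.support v ⊆ P) (k : P) :
    (restrictMatrix P X *ᵥ fun l : P => v l) k = (X *ᵥ v) k :=
  sum_coe_eq_sum_of_support_subset (f := fun l => X k l * v l) fun l hl => by
    have : v l = 0 := by
      by_contra h
      exact hl (hv h)
    rw [this, mul_zero]

theorem dotProduct_restrictMatrix_mulVec (X : Matrix (Fin p) (Fin p) ℝ) {v : Fin p → ℝ}
    (hv : Function.support v ⊆ P) :
    (fun l : P => v l) ⬝ᵥ restrictMatrix P X *ᵥ (fun l : P => v l) = v ⬝ᵥ X *ᵥ v := by
  have : ∀ k : P, v k * (restrictMatrix P X *ᵥ fun l : P => v l) k = v k * (X *ᵥ v) k :=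
    fun k => by rw [restrictMatrix_mulVec X hv]
  refine (Finset.sum_congr rfl fun k _ => this k).trans
    (sum_coe_eq_sum_of_support_subset (f := fun l => v l * (X *ᵥ v) l) fun l hl => ?_)
  have : v l = 0 := by
    by_contra h
    exact hl (hv h)
  rw [this, zero_mul]

theorem restrictMatrix_mem_rankOneSums {A : Set (Fin p → ℝ)} {W : Matrix (Fin p) (Fin p) ℝ}
    (hW : W ∈ rankOneSums A) :
    restrictMatrix P W ∈ rankOneSums ((fun (v : Fin p → ℝ) (l : P) => v l) '' A) := by
  refine rankOneSums_induction (motive := fun W =>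
    restrictMatrix P W ∈ rankOneSums ((fun (v : Fin p → ℝ) (l : P) => v l) '' A))
    (fun v hv => ?_) ?_ (fun V W hV hW => ?_) hW
  · exact vecMulVec_mem_rankOneSums (v := fun l : P => v l) ⟨v, hv, rfl⟩
  · have : restrictMatrix P (0 : Matrix (Fin p) (Fin p) ℝ) = 0 := rfl
    rw [this]
    exact zero_mem _
  · have : restrictMatrix P (V + W) = restrictMatrix P V + restrictMatrix P W := rfl
    rw [this]
    exact add_mem hV hW

theorem trace_restrictMatrix_mul {A : Set (Fin p → ℝ)} (hA : ∀ v ∈ A, Function.support v ⊆ P)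
    (X : Matrix (Fin p) (Fin p) ℝ) {W : Matrix (Fin p) (Fin p) ℝ} (hW : W ∈ rankOneSums A) :
    (restrictMatrix P X * restrictMatrix P W).trace = (X * W).trace := by
  refine rankOneSums_induction
    (motive := fun W => (restrictMatrix P X * restrictMatrix P W).trace = (X * W).trace)
    (fun v hv => ?_) ?_ (fun V W hV hW => ?_) hW
  · have : restrictMatrix P (vecMulVec v v) = vecMulVec (fun l : P => v l) fun l : P => v l := rfl
    rw [this, trace_mul_vecMulVec_self, trace_mul_vecMulVec_self,
      dotProduct_restrictMatrix_mulVec X (hA v hv)]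
  · have : restrictMatrix P (0 : Matrix (Fin p) (Fin p) ℝ) = 0 := rfl
    rw [this, Matrix.mul_zero, Matrix.mul_zero, trace_zero, trace_zero]
  · have : restrictMatrix P (V + W) = restrictMatrix P V + restrictMatrix P W := rfl
    rw [this, Matrix.mul_add, Matrix.mul_add, trace_add, trace_add, hV, hW]

theorem apply_eq_zero_of_mem_rankOneSums {A : Set (Fin p → ℝ)}
    (hA : ∀ v ∈ A, Function.support v ⊆ P) {W : Matrix (Fin p) (Fin p) ℝ} (hW : W ∈ rankOneSums A)
    {i j : Fin p} (hij : ¬(i ∈ P ∧ j ∈ P)) : W i j = 0 := by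
  refine rankOneSums_induction (motive := fun W => W i j = 0) (fun v hv => ?_) rfl
    (fun V W hV hW => by rw [Matrix.add_apply, hV, hW, add_zero]) hW
  rw [vecMulVec_apply, mul_eq_zero]
  by_contra! h
  exact hij ⟨hA v hv h.1, hA v hv h.2⟩

theorem extendMatrix_restrictMatrix {A : Set (Fin p → ℝ)} (hA : ∀ v ∈ A, Function.support v ⊆ P)
    {W : Matrix (Fin p) (Fin p) ℝ} (hW : W ∈ rankOneSums A) :
    extendMatrix P (restrictMatrix P W) = W := by
  ext i j
  by_cases h : i ∈ P ∧ j ∈ P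
  · simp [extendMatrix, restrictMatrix, h]
  · simp [extendMatrix, h, apply_eq_zero_of_mem_rankOneSums hA hW h]

theorem isSymm_restrictMatrix {X : Matrix (Fin p) (Fin p) ℝ} (hX : X.IsSymm) :
    (restrictMatrix P X).IsSymm := hX.submatrix _

/-- Principal submatrices of copositive matrices are copositive. -/
theorem dotProduct_restrictMatrix_mulVec_nonneg {X : Matrix (Fin p) (Fin p) ℝ}
    (hX : X ∈ copositiveCone p) (v : P → ℝ) (hv : ∀ k, 0 ≤ v k) :
    0 ≤ v ⬝ᵥ restrictMatrix P X *ᵥ v := by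
  let v' : Fin p → ℝ := fun k => if h : k ∈ P then v ⟨k, h⟩ else 0
  have h1 : (fun l : P => v' l) = v := by
    ext l
    simp [v']
  have h2 : Function.support v' ⊆ P := fun k hk => by
    by_contra h
    exact hk (dif_neg h)
  rw [← h1, dotProduct_restrictMatrix_mulVec X h2]
  refine hX.2 v' fun k => ?_
  by_cases h : k ∈ P
  · simpa [v', h] using hv ⟨k, h⟩
  · simp [v', h]

end Restriction

/-- Any vector becomes nonnegative after adding a large multiple of a positive vector. -/
theorem exists_smul_add_nonneg {ι : Type*} [Fintype ι] {e : ι → ℝ} (he : ∀ k, 0 < e k)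
    (y : ι → ℝ) : ∃ N : ℝ, ∀ k, 0 ≤ (N • e + y) k := by
  refine ⟨∑ k, |y k| / e k, fun k => ?_⟩
  have h1 : |y k| / e k ≤ ∑ k, |y k| / e k :=
    Finset.single_le_sum (f := fun k => |y k| / e k)
      (fun k _ => div_nonneg (abs_nonneg _) (he k).le) (Finset.mem_univ k)
  rw [div_le_iff₀ (he k)] at h1
  simp only [Pi.add_apply, Pi.smul_apply, smul_eq_mul]
  linarith [neg_abs_le (y k)]

theorem dotProduct_mulVec_smul_add {ι : Type*} [Fintype ι] {Y : Matrix ι ι ℝ} (hY : Y.IsSymm)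
    {e : ι → ℝ} (he : Y *ᵥ e = 0) (N : ℝ) (y : ι → ℝ) :
    (N • e + y) ⬝ᵥ Y *ᵥ (N • e + y) = y ⬝ᵥ Y *ᵥ y := by
  rw [mulVec_add, mulVec_smul, he, smul_zero, zero_add, add_dotProduct, smul_dotProduct,
    hY.dotProduct_mulVec_comm e, he, dotProduct_zero, smul_zero, zero_add]

/-- A copositive matrix with a positive vector in its kernel is positive semidefinite. -/
theorem posSemidef_of_pos_kernel {ι : Type*} [Fintype ι] {Y : Matrix ι ι ℝ} (hY : Y.IsSymm)
    (hcop : ∀ v : ι → ℝ, (∀ k, 0 ≤ v k) → 0 ≤ v ⬝ᵥ Y *ᵥ v) {e : ι → ℝ} (he : ∀ k, 0 < e k)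
    (hYe : Y *ᵥ e = 0) : Y.PosSemidef := by
  refine PosSemidef.of_dotProduct_mulVec_nonneg
    (by rw [IsHermitian, conjTranspose_eq_transpose_of_trivial, hY.eq]) fun y => ?_
  obtain ⟨N, hN⟩ := exists_smul_add_nonneg he y
  rw [star_trivial, ← dotProduct_mulVec_smul_add hY hYe N y]
  exact hcop _ hN

/-! ### The kernel of a principal block -/

section Basis

variable {p : ℕ} {I Ib : Set (Fin p → ℝ)}

theorem IsRankBasis.span_eq (h : IsRankBasis I Ib) :
    Submodule.span ℝ Ib = Submodule.span ℝ I :=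
  Submodule.eq_of_le_of_finrank_eq (Submodule.span_mono h.1) h.2.1.symm

theorem IsRankBasis.linearIndependent (h : IsRankBasis I Ib) :
    LinearIndependent ℝ (fun j : Ib => j.1) := by
  have := h.2.2.1.fintype
  rw [linearIndependent_iff_card_eq_finrank_span, Subtype.range_coe, h.2.2.2,
    Set.ncard_eq_toFinset_card', Set.toFinset_card]

/-- The matrix with the vectors of `Ib`, restricted to the index set `P`, as columns. -/
def basisMatrix (P : Finset (Fin p)) (Ib : Set (Fin p → ℝ)) : Matrix P Ib ℝ :=
  Matrix.of fun k j => j.1 k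

theorem exists_basisMatrix_mulVec_eq [Fintype Ib] {P : Finset (Fin p)} {v : Fin p → ℝ}
    (hv : v ∈ Submodule.span ℝ Ib) : ∃ x, (fun l : P => v l) = basisMatrix P Ib *ᵥ x := by
  rw [← Subtype.range_coe (s := Ib), Submodule.mem_span_range_iff_exists_fun] at hv
  obtain ⟨c, rfl⟩ := hv
  refine ⟨c, ?_⟩
  ext l
  simp [basisMatrix, mulVec, dotProduct, Finset.sum_apply, mul_comm]

theorem eq_zero_of_basisMatrix_mulVec_eq_zero [Fintype Ib]
    (hb : IsRankBasis I Ib) {x : Ib → ℝ}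
    (hx : basisMatrix (supportIndices I) Ib *ᵥ x = 0) : x = 0 := by
  have hsum : ∑ j, x j • j.1 = (0 : Fin p → ℝ) := by
    ext k
    rw [Finset.sum_apply]
    by_cases hk : k ∈ supportIndices I
    · have := congrFun hx ⟨k, hk⟩
      simpa [basisMatrix, mulVec, dotProduct, mul_comm] using this
    · refine Finset.sum_eq_zero fun j _ => ?_
      have : j.1 k = 0 := by
        by_contra h
        exact hk (support_subset_supportIndices (hb.1 j.2) h)
      simp [this]
  ext j
  exact Fintype.linearIndependent_iff.1 hb.linearIndependent x hsum j

end Basis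

section FaceStability

variable {p m : ℕ} {X₀ : Matrix (Fin p) (Fin p) ℝ} {J Jb : Fin m → Set (Fin p → ℝ)}

theorem IsVertexPartition.exists_pos_mem_span (hX₀ : X₀ ∈ copositiveCone p)
    (hJ : IsVertexPartition X₀ m J) (s : Fin m) :
    ∃ e ∈ Submodule.span ℝ (J s), ∀ k ∈ supportIndices (J s), 0 < e k := by
  have hfin : (J s).Finite := (finite_zeroVertices hX₀).subset (hJ.subset s)
  have hnn : ∀ τ ∈ J s, ∀ k, 0 ≤ τ k := fun τ hτ => (zeroVertices_subset (hJ.subset s hτ)).1.1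
  refine ⟨∑ τ ∈ hfin.toFinset, τ, Submodule.sum_mem _ fun τ hτ =>
    Submodule.subset_span (hfin.mem_toFinset.1 hτ), fun k hk => ?_⟩
  obtain ⟨τ, hτ, hkτ⟩ := mem_supportIndices.1 hk
  rw [Finset.sum_apply]
  exact Finset.sum_pos' (fun σ hσ => hnn σ (hfin.mem_toFinset.1 hσ) k)
    ⟨τ, hfin.mem_toFinset.2 hτ, lt_of_le_of_ne (hnn τ hτ k) (Ne.symm hkτ)⟩

theorem restrictMatrix_mul_basisMatrix {s : Fin m} [Fintype (Jb s)]
    (hM : ∀ s, ∀ τ ∈ J s, zeroIndices X₀ τ = (supportIndices (J s) : Set (Fin p)))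
    (hb : IsRankBasis (J s) (Jb s)) :
    restrictMatrix (supportIndices (J s)) X₀ * basisMatrix (supportIndices (J s)) (Jb s) = 0 := by
  ext k j
  have hj := hb.1 j.2
  have h1 := restrictMatrix_mulVec X₀ (support_subset_supportIndices hj) k
  have h2 : k.1 ∈ zeroIndices X₀ j.1 := by
    rw [hM s _ hj]
    exact k.2
  exact h1.trans h2

/-- A vector in the kernel of the block of `P_*(s)` is a combination of the vertices in `J(s)`:
added to a large multiple of a positive combination of these it gives a nonnegative zero. -/
theorem IsVertexPartition.exists_mulVec_eq_of_kernel (hX₀ : X₀ ∈ copositiveCone p)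
    (hJ : IsVertexPartition X₀ m J)
    (hM : ∀ s, ∀ τ ∈ J s, zeroIndices X₀ τ = (supportIndices (J s) : Set (Fin p))) {s : Fin m}
    [Fintype (Jb s)] (hb : IsRankBasis (J s) (Jb s)) {e : Jb s → ℝ}
    (he : ∀ k, 0 < (basisMatrix (supportIndices (J s)) (Jb s) *ᵥ e) k)
    (u : supportIndices (J s) → ℝ) (hu : restrictMatrix (supportIndices (J s)) X₀ *ᵥ u = 0) :
    ∃ x, u = basisMatrix (supportIndices (J s)) (Jb s) *ᵥ x := by
  revert u
  set P := supportIndices (J s) with hP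
  set B := basisMatrix P (Jb s) with hB
  intro u hu
  have hsymm : (restrictMatrix P X₀).IsSymm := isSymm_restrictMatrix hX₀.1
  have hYe : restrictMatrix P X₀ *ᵥ (B *ᵥ e) = 0 := by
    rw [mulVec_mulVec, restrictMatrix_mul_basisMatrix hM hb, zero_mulVec]
  obtain ⟨N, hN⟩ := exists_smul_add_nonneg he u
  let v : Fin p → ℝ := fun k => if h : k ∈ P then (N • (B *ᵥ e) + u) ⟨k, h⟩ else 0
  have h1 : (fun l : P => v l) = N • (B *ᵥ e) + u := by
    ext l
    simp [v]
  have h2 : Function.support v ⊆ P := fun k hk => by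
    by_contra h
    exact hk (dif_neg h)
  have hv : v ∈ supportedZeros X₀ P := by
    refine ⟨fun k => ?_, h2, ?_⟩
    · by_cases h : k ∈ P
      · simpa [v, h] using hN ⟨k, h⟩
      · simp [v, h]
    · rw [← dotProduct_restrictMatrix_mulVec X₀ h2, h1, dotProduct_mulVec_smul_add hsymm hYe, hu,
        dotProduct_zero]
  have hspan := hJ.mem_span_of_mem_supportedZeros hX₀ hM hv
  rw [← hb.span_eq] at hspan
  obtain ⟨x, hx⟩ := exists_basisMatrix_mulVec_eq (P := P) hspan
  refine ⟨x - N • e, ?_⟩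
  rw [mulVec_sub, mulVec_smul, ← hx, h1, add_sub_cancel_left]

/-- Stability of complementarity on the face of `s`, at the sum `V` of an element of the cone over
the face and a positive multiple of all pair matrices. -/
theorem IsVertexPartition.eventually_restrictMatrix_mul_eq_zero (hX₀ : X₀ ∈ copositiveCone p)
    (hJ : IsVertexPartition X₀ m J)
    (hM : ∀ s, ∀ τ ∈ J s, zeroIndices X₀ τ = (supportIndices (J s) : Set (Fin p))) {s : Fin m}
    [Fintype (Jb s)] (hb : IsRankBasis (J s) (Jb s)) {V' : Matrix (Fin p) (Fin p) ℝ} {δ : ℝ}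
    (hδ : 0 < δ) (hV' : V' ∈ rankOneSums (supportedZeros X₀ (supportIndices (J s)))) :
    ∀ᶠ q : Matrix (Fin p) (Fin p) ℝ × Matrix (Fin p) (Fin p) ℝ in 𝓝 (X₀, V' + δ •
        ∑ i : Jb s, ∑ j : Jb s, vecMulVec (i.1 + j.1) (i.1 + j.1)),
      q.1 ∈ copositiveCone p →
      q.2 ∈ rankOneSums {v | (∀ k, 0 ≤ v k) ∧ Function.support v ⊆ supportIndices (J s)} →
      (q.1 * q.2).trace = 0 →
      restrictMatrix (supportIndices (J s)) q.1 * restrictMatrix (supportIndices (J s)) q.2 = 0 := by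
  classical
  set P := supportIndices (J s) with hP
  set B := basisMatrix P (Jb s) with hB
  obtain ⟨e, he, hepos⟩ := hJ.exists_pos_mem_span hX₀ s
  rw [← hb.span_eq] at he
  obtain ⟨x, hx⟩ := exists_basisMatrix_mulVec_eq (P := P) he
  have hxpos : ∀ k, 0 < (B *ᵥ x) k := fun k => by
    rw [hB, ← hx]
    exact hepos k.1 k.2
  have hYB : restrictMatrix P X₀ * B = 0 := restrictMatrix_mul_basisMatrix hM hb
  have hpsd : (restrictMatrix P X₀).PosSemidef :=
    posSemidef_of_pos_kernel (isSymm_restrictMatrix hX₀.1)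
      (dotProduct_restrictMatrix_mulVec_nonneg hX₀) hxpos
      (by rw [mulVec_mulVec, hYB, zero_mulVec])
  have hlocal := eventually_mul_eq_zero_of_trace_eq_zero hpsd hYB
    (V' := restrictMatrix P V') (e := x) (δ := δ)
    (fun u hu hBu => by
      obtain ⟨y, rfl⟩ := hJ.exists_mulVec_eq_of_kernel hX₀ hM hb hxpos u hu
      have : (B *ᵥ y) ⬝ᵥ (B *ᵥ y) = 0 := by
        rw [dotProduct_mulVec, ← mulVec_transpose, hBu, zero_dotProduct]
      exact dotProduct_self_eq_zero.1 this)
    (fun y hy => eq_zero_of_basisMatrix_mulVec_eq_zero hb hy)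
    (fun k j => (zeroVertices_subset (hJ.subset s (hb.1 j.2))).1.1 k) hxpos hδ
    (by
      refine rankOneSums_mono ?_ (restrictMatrix_mem_rankOneSums hV')
      rintro _ ⟨v, hv, rfl⟩
      refine ⟨fun k => hv.1 k, exists_basisMatrix_mulVec_eq ?_⟩
      rw [hb.span_eq]
      exact hJ.mem_span_of_mem_supportedZeros hX₀ hM hv)
  have hlim : restrictMatrix P (V' + δ • ∑ i : Jb s, ∑ j : Jb s,
      vecMulVec (i.1 + j.1) (i.1 + j.1)) = restrictMatrix P V' + δ • ∑ i, ∑ j,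
        vecMulVec (B.col i + B.col j) (B.col i + B.col j) := by
    ext k l
    simp [restrictMatrix, Matrix.sum_apply, vecMulVec_apply, hB, basisMatrix]
  have hc : Continuous (restrictMatrix P) := continuous_id.matrix_submatrix _ _
  have hc2 : Continuous fun q : Matrix (Fin p) (Fin p) ℝ × Matrix (Fin p) (Fin p) ℝ =>
      (restrictMatrix P q.1, restrictMatrix P q.2) :=
    (hc.comp continuous_fst).prodMk (hc.comp continuous_snd)
  rw [← hlim] at hlocal
  filter_upwards [(hc2.tendsto (X₀, _)).eventually hlocal] with q hq h1 h2 h3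
  refine hq (isSymm_restrictMatrix h1.1) (dotProduct_restrictMatrix_mulVec_nonneg h1) ?_ ?_
  · refine rankOneSums_mono ?_ (restrictMatrix_mem_rankOneSums h2)
    rintro _ ⟨v, hv, rfl⟩
    exact fun k => hv.1 k
  · rw [trace_restrictMatrix_mul (fun v hv => hv.2) q.1 h2, h3]

end FaceStability

/-! ### Decomposition of completely positive matrices near the given pair -/

section Decomposition

variable {p m : ℕ} {X₀ U₀ : Matrix (Fin p) (Fin p) ℝ} {J Jb : Fin m → Set (Fin p → ℝ)}

/-- A completely positive matrix orthogonal to `X` with zero diagonal outside `P` is generated by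
zeros of `X` supported in `P`: the zeros are those of `X` plus the indicator of the complement of
`P` on the diagonal. -/
theorem mem_rankOneSums_supportedZeros {X V : Matrix (Fin p) (Fin p) ℝ} {P : Finset (Fin p)}
    (hX : X ∈ copositiveCone p) (hV : V ∈ completelyPositiveCone p) (htr : (X * V).trace = 0)
    (hdiag : ∀ k ∉ P, V k k = 0) : V ∈ rankOneSums (supportedZeros X P) := by
  let d : Fin p → ℝ := fun k => if k ∈ P then 0 else 1
  have hd : ∀ v : Fin p → ℝ, v ⬝ᵥ diagonal d *ᵥ v = ∑ k, d k * (v k * v k) := fun v =>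
    Finset.sum_congr rfl fun k _ => by rw [mulVec_diagonal]; ring
  have hd0 : ∀ (v : Fin p → ℝ) (k : Fin p), 0 ≤ d k * (v k * v k) := fun v k =>
    mul_nonneg (by simp only [d]; split_ifs <;> norm_num) (mul_self_nonneg _)
  have htr' : ((X + diagonal d) * V).trace = 0 := by
    rw [add_mul, trace_add, htr, zero_add]
    refine Finset.sum_eq_zero fun k _ => ?_
    rw [diag_apply, diagonal_mul]
    by_cases h : k ∈ P
    · simp [d, h]
    · simp [hdiag k h]
  have hsum : ∀ v : Fin p → ℝ, v ⬝ᵥ (X + diagonal d) *ᵥ v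
      = v ⬝ᵥ X *ᵥ v + ∑ k, d k * (v k * v k) := fun v => by
    rw [add_mulVec, dotProduct_add, hd]
  refine rankOneSums_mono ?_ (mem_rankOneSums_zeros (X := X + diagonal d) ?_
    (mem_rankOneSums_of_mem_completelyPositiveCone hV) htr')
  · rintro v ⟨hv, h⟩
    rw [hsum] at h
    have h1 := hX.2 v hv
    have h2 := Finset.sum_nonneg fun k (_ : k ∈ Finset.univ) => hd0 v k
    refine ⟨hv, fun k hk => ?_, by linarith⟩
    by_contra hkP
    have h3 := (Finset.sum_eq_zero_iff_of_nonneg fun k _ => hd0 v k).1 (by linarith) k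
      (Finset.mem_univ k)
    have hdk : d k = 1 := if_neg hkP
    rw [hdk, one_mul, mul_self_eq_zero] at h3
    exact hk h3
  · intro v hv
    rw [hsum]
    exact add_nonneg (hX.2 v hv) (Finset.sum_nonneg fun k _ => hd0 v k)

/-- If all zeros of `X` are supported in one of the sets `P s`, then a complementary completely
positive matrix is a sum of complementary completely positive blocks. -/
theorem exists_sum_of_mem_complementaritySet {X U : Matrix (Fin p) (Fin p) ℝ}
    {P : Fin m → Finset (Fin p)} (hXU : (X, U) ∈ complementaritySet p)
    (hsupp : ∀ v : Fin p → ℝ, (∀ k, 0 ≤ v k) → v ⬝ᵥ X *ᵥ v = 0 →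
      ∃ s, Function.support v ⊆ P s) :
    ∃ W : Fin m → Matrix (Fin p) (Fin p) ℝ,
      (∀ s, W s ∈ rankOneSums (supportedZeros X (P s))) ∧ U = ∑ s, W s := by
  refine exists_sum_of_mem_rankOneSums (rankOneSums_mono ?_ (mem_rankOneSums_zeros hXU.1.2
    (mem_rankOneSums_of_mem_completelyPositiveCone hXU.2.1) hXU.2.2))
  rintro v ⟨hv, h0⟩
  obtain ⟨s, hs⟩ := hsupp v hv h0
  exact Set.mem_iUnion.2 ⟨s, hv, hs, h0⟩

theorem supportedZeros_subset {X : Matrix (Fin p) (Fin p) ℝ} {P : Finset (Fin p)} :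
    supportedZeros X P ⊆ {v | (∀ k, 0 ≤ v k) ∧ Function.support v ⊆ P} :=
  fun _ hv => ⟨hv.1, hv.2.1⟩

theorem trace_mul_eq_zero_of_mem_rankOneSums_supportedZeros {X W : Matrix (Fin p) (Fin p) ℝ}
    {P : Finset (Fin p)} (hW : W ∈ rankOneSums (supportedZeros X P)) : (X * W).trace = 0 := by
  refine rankOneSums_induction (motive := fun W => (X * W).trace = 0)
    (fun v hv => ?_) (by simp) (fun V W hV hW => ?_) hW
  · rw [trace_mul_vecMulVec_self, hv.2.2]
  · rw [mul_add, trace_add, hV, hW, add_zero]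

theorem isClosed_completelyPositiveCone : IsClosed (completelyPositiveCone p) := by
  have h1 : IsClosed {U : Matrix (Fin p) (Fin p) ℝ | U.IsSymm} :=
    isClosed_eq continuous_id.matrix_transpose continuous_id
  have h2 : IsClosed {U : Matrix (Fin p) (Fin p) ℝ | ∀ X ∈ copositiveCone p, 0 ≤ (U * X).trace} := by
    simp only [Set.ofPred_forall]
    exact isClosed_iInter fun X => isClosed_iInter fun _ =>
      isClosed_le continuous_const (continuous_id.matrix_mul continuous_const).matrix_trace
  exact h1.inter h2

/-- Strict complementarity makes all pair matrices of the parts appear with a positive coefficient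
in a decomposition of `U₀`. -/
theorem IsVertexPartition.exists_sum_add_pair (hX₀ : X₀ ∈ copositiveCone p)
    (hJ : IsVertexPartition X₀ m J)
    (hM : ∀ s, ∀ τ ∈ J s, zeroIndices X₀ τ = (supportIndices (J s) : Set (Fin p)))
    [∀ s, Fintype (Jb s)] (hb : ∀ s, IsRankBasis (J s) (Jb s))
    (hSC : StrictlyComplementary U₀ X₀) :
    ∃ δ : ℝ, 0 < δ ∧ ∃ V' : Fin m → Matrix (Fin p) (Fin p) ℝ,
      (∀ s, V' s ∈ rankOneSums (supportedZeros X₀ (supportIndices (J s)))) ∧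
      U₀ = ∑ s, (V' s + δ • ∑ i : Jb s, ∑ j : Jb s, vecMulVec (i.1 + j.1) (i.1 + j.1)) := by
  set H : Fin m → Matrix (Fin p) (Fin p) ℝ :=
    fun s => ∑ i : Jb s, ∑ j : Jb s, vecMulVec (i.1 + j.1) (i.1 + j.1) with hH
  have hcol : ∀ s (i : Jb s), (∀ k, 0 ≤ i.1 k) ∧ Function.support i.1 ⊆ supportIndices (J s) ∧
      ∀ k ∈ supportIndices (J s), (X₀ *ᵥ i.1) k = 0 := fun s i => by
    have hi := (hb s).1 i.2
    refine ⟨(zeroVertices_subset (hJ.subset s hi)).1.1, support_subset_supportIndices hi,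
      fun k hk => ?_⟩
    have : k ∈ zeroIndices X₀ i.1 := by
      rw [hM s _ hi]
      exact hk
    exact this
  have hpair : ∀ s (i j : Jb s), i.1 + j.1 ∈ supportedZeros X₀ (supportIndices (J s)) := by
    intro s i j
    have hsupp : Function.support (i.1 + j.1) ⊆ supportIndices (J s) :=
      (Function.support_add _ _).trans (Set.union_subset (hcol s i).2.1 (hcol s j).2.1)
    refine ⟨fun k => add_nonneg ((hcol s i).1 k) ((hcol s j).1 k), hsupp, ?_⟩
    refine Finset.sum_eq_zero fun k _ => ?_
    by_cases hk : (i.1 + j.1) k = 0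
    · rw [hk, zero_mul]
    · rw [mulVec_add, Pi.add_apply (X₀ *ᵥ i.1), (hcol s i).2.2 k (hsupp hk),
        (hcol s j).2.2 k (hsupp hk), add_zero, mul_zero]
  have hHs : ∀ s, H s ∈ rankOneSums (supportedZeros X₀ (supportIndices (J s))) := fun s =>
    sum_mem fun i _ => sum_mem fun j _ => vecMulVec_mem_rankOneSums (hpair s i j)
  have hface : ∑ s, H s ∈ completelyPositiveCone p ∩ symmOrthogonal X₀ := by
    have hcp : ∑ s, H s ∈ completelyPositiveCone p :=
      mem_completelyPositiveCone_of_mem_rankOneSums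
        (sum_mem fun s _ => rankOneSums_mono (fun v hv => hv.1) (hHs s))
    refine ⟨hcp, hcp.1, ?_⟩
    rw [Finset.mul_sum, trace_sum]
    exact Finset.sum_eq_zero fun s _ =>
      trace_mul_eq_zero_of_mem_rankOneSums_supportedZeros (hHs s)
  have hcone : ∀ c : ℝ, 0 ≤ c → ∀ U ∈ completelyPositiveCone p ∩ symmOrthogonal X₀,
      c • U ∈ completelyPositiveCone p ∩ symmOrthogonal X₀ := by
    rintro c hc U ⟨⟨hU1, hU2⟩, _, hU3⟩
    refine ⟨⟨hU1.smul c, fun X hX => ?_⟩, hU1.smul c, ?_⟩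
    · rw [Matrix.smul_mul, trace_smul]
      exact mul_nonneg hc (hU2 X hX)
    · rw [Matrix.mul_smul, trace_smul, hU3, smul_zero]
  obtain ⟨δ, hδ, hmem⟩ := exists_sub_smul_mem_of_mem_intrinsicInterior hcone hSC hface
  obtain ⟨V', hV', hsum⟩ := exists_sum_of_mem_complementaritySet (X := X₀)
    (P := fun s => supportIndices (J s)) ⟨hX₀, hmem.1, hmem.2.2⟩ fun v hv h0 => by
      by_cases hne : v = 0
      · exact ⟨⟨0, hJ.one_le⟩, by simp [hne]⟩
      · obtain ⟨s, hs, _⟩ := hJ.exists_part hX₀ hM hv h0 hne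
        exact ⟨s, hs⟩
  refine ⟨δ, hδ, V', hV', ?_⟩
  rw [Finset.sum_add_distrib, ← hsum, ← Finset.smul_sum, sub_add_cancel]

/-- Complementary pairs near `(X₀, U₀)` decompose into blocks that annihilate each other. -/
theorem IsVertexPartition.eventually_exists_sum (h₀ : (X₀, U₀) ∈ complementaritySet p)
    (hJ : IsVertexPartition X₀ m J)
    (hM : ∀ s, ∀ τ ∈ J s, zeroIndices X₀ τ = (supportIndices (J s) : Set (Fin p)))
    (hb : ∀ s, IsRankBasis (J s) (Jb s)) (hSC : StrictlyComplementary U₀ X₀)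
    (hli : LinearIndependent ℝ (fun q : (Σ s : Fin m, Sym2 (Jb s)) => pairMatrix q.2)) :
    ∀ᶠ q in 𝓝 (X₀, U₀), q ∈ complementaritySet p →
      ∃ W : Fin m → Matrix (Fin p) (Fin p) ℝ,
        (∀ s, W s ∈ rankOneSums (supportedZeros q.1 (supportIndices (J s)))) ∧ q.2 = ∑ s, W s ∧
        ∀ s, restrictMatrix (supportIndices (J s)) q.1 *
          restrictMatrix (supportIndices (J s)) (W s) = 0 := by
  classical
  have hX₀ := h₀.1
  have := fun s => (hb s).2.2.1.fintype
  obtain ⟨δ, hδ, V', hV', hU₀⟩ := hJ.exists_sum_add_pair hX₀ hM hb hSC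
  by_contra hcon
  obtain ⟨F, hF⟩ := exists_ultrafilter_iff.2
    (frequently_iff_neBot.1 (not_eventually.1 hcon))
  have hFn : (F : Filter _) ≤ 𝓝 (X₀, U₀) := hF.trans inf_le_left
  have hFbad := hF.trans inf_le_right (mem_principal_self _)
  have hX : Tendsto (fun q : Matrix (Fin p) (Fin p) ℝ × Matrix (Fin p) (Fin p) ℝ => q.1) F
      (𝓝 X₀) := (continuous_fst.tendsto (X₀, U₀)).mono_left hFn
  have hU : Tendsto (fun q : Matrix (Fin p) (Fin p) ℝ × Matrix (Fin p) (Fin p) ℝ => q.2) F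
      (𝓝 U₀) := (continuous_snd.tendsto (X₀, U₀)).mono_left hFn
  have hdec : ∀ᶠ q : Matrix (Fin p) (Fin p) ℝ × Matrix (Fin p) (Fin p) ℝ in F,
      ∃ W : Fin m → Matrix (Fin p) (Fin p) ℝ, q ∈ complementaritySet p ∧
        (∀ s, W s ∈ rankOneSums (supportedZeros q.1 (supportIndices (J s)))) ∧ q.2 = ∑ s, W s ∧
        ¬ ∀ s, restrictMatrix (supportIndices (J s)) q.1 *
          restrictMatrix (supportIndices (J s)) (W s) = 0 := by
    filter_upwards [hFbad, hX.eventually (hJ.eventually_exists_support_subset hX₀ hM)] with q hq hq'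
    obtain ⟨hqC, hqW⟩ := Classical.not_imp.1 hq
    obtain ⟨W, hW, hsum⟩ := exists_sum_of_mem_complementaritySet hqC (hq' hqC.1)
    exact ⟨W, hqC, hW, hsum, fun h => hqW ⟨W, hW, hsum, h⟩⟩
  obtain ⟨W, hW⟩ := hdec.choice
  have hnn : ∀ᶠ q in F, ∀ s i j, 0 ≤ W q s i j := by
    filter_upwards [hW] with q hq s
    exact apply_nonneg_of_mem_rankOneSums (fun v hv => hv.1) (hq.2.1 s)
  -- The blocks are entrywise between zero and the entries of the sum, hence bounded.
  have hbdd : ∀ s, ∀ᶠ q in F, W q s ∈ Set.univ.pi fun i => Set.univ.pi fun j =>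
      Set.Icc 0 (U₀ i j + 1) := by
    intro s
    have hUb : ∀ᶠ q : Matrix (Fin p) (Fin p) ℝ × Matrix (Fin p) (Fin p) ℝ in F,
        ∀ i j, q.2 i j < U₀ i j + 1 :=
      eventually_all.2 fun i => eventually_all.2 fun j =>
        ((tendsto_pi_nhds.1 ((tendsto_pi_nhds.1 hU) i)) j).eventually
          (gt_mem_nhds (lt_add_one _))
    filter_upwards [hW, hnn, hUb] with q hq hq' hqU i _ j _
    refine ⟨hq' s i j, le_trans ?_ (hqU i j).le⟩
    rw [hq.2.2.1, Matrix.sum_apply]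
    exact Finset.single_le_sum (f := fun s => W q s i j) (fun s _ => hq' s i j)
      (Finset.mem_univ s)
  have hcpt : IsCompact (Set.univ.pi fun i : Fin p => Set.univ.pi fun j : Fin p =>
      Set.Icc 0 (U₀ i j + 1)) :=
    isCompact_univ_pi fun i => isCompact_univ_pi fun j => isCompact_Icc
  have hlim : ∀ s, ∃ V : Matrix (Fin p) (Fin p) ℝ, Tendsto (fun q => W q s) F (𝓝 V) := by
    intro s
    obtain ⟨V, _, hV⟩ := hcpt.ultrafilter_le_nhds' (F.map fun q => W q s) (hbdd s)
    exact ⟨V, hV⟩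
  choose V hV using hlim
  have hVsum : U₀ = ∑ s, V s := by
    refine tendsto_nhds_unique hU ((tendsto_finsetSum Finset.univ fun s _ => hV s).congr' ?_)
    filter_upwards [hW] with q hq
    exact hq.2.2.1.symm
  have hVmem : ∀ s, V s ∈ rankOneSums (supportedZeros X₀ (supportIndices (J s))) := by
    intro s
    refine mem_rankOneSums_supportedZeros hX₀ ?_ ?_ fun k hk => ?_
    · refine isClosed_completelyPositiveCone.mem_of_tendsto (hV s) ?_
      filter_upwards [hW] with q hq
      exact mem_completelyPositiveCone_of_mem_rankOneSums
        (rankOneSums_mono (fun v hv => hv.1) (hq.2.1 s))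
    · have hc : Continuous fun q : Matrix (Fin p) (Fin p) ℝ × Matrix (Fin p) (Fin p) ℝ =>
          (q.1 * q.2).trace := (continuous_fst.matrix_mul continuous_snd).matrix_trace
      refine tendsto_nhds_unique ((hc.tendsto (X₀, V s)).comp (hX.prodMk_nhds (hV s)))
        (tendsto_const_nhds.congr' ?_)
      filter_upwards [hW] with q hq
      exact (trace_mul_eq_zero_of_mem_rankOneSums_supportedZeros (hq.2.1 s)).symm
    · refine tendsto_nhds_unique ((tendsto_pi_nhds.1 ((tendsto_pi_nhds.1 (hV s)) k)) k)
        (tendsto_const_nhds.congr' ?_)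
      filter_upwards [hW] with q hq
      exact (apply_eq_zero_of_mem_rankOneSums (fun v hv => hv.2.1) (hq.2.1 s)
        fun h => hk h.1).symm
  have hspan : ∀ s, ∀ v ∈ supportedZeros X₀ (supportIndices (J s)),
      v ∈ Submodule.span ℝ (Jb s) := fun s v hv => by
    rw [(hb s).span_eq]
    exact hJ.mem_span_of_mem_supportedZeros hX₀ hM hv
  -- By linear independence the limits are the blocks provided by strict complementarity.
  have hVeq : ∀ s, V s =
      V' s + δ • ∑ i : Jb s, ∑ j : Jb s, vecMulVec (i.1 + j.1) (i.1 + j.1) := by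
    intro s
    refine sub_eq_zero.1 (eq_zero_of_sum_eq_zero_of_mem_span
      (f := fun s => pairMatrix (I := Jb s)) hli (D := fun s => V s -
        (V' s + δ • ∑ i : Jb s, ∑ j : Jb s, vecMulVec (i.1 + j.1) (i.1 + j.1)))
      (fun s => ?_) ?_ s)
    · refine Submodule.sub_mem _ (mem_span_pairMatrix_of_mem_rankOneSums (hspan s) (hVmem s))
        (Submodule.add_mem _ (mem_span_pairMatrix_of_mem_rankOneSums (hspan s) (hV' s))
          (Submodule.smul_mem _ _ ?_))
      exact Submodule.sum_mem _ fun i _ => Submodule.sum_mem _ fun j _ =>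
        Submodule.subset_span ⟨s(i, j), rfl⟩
    · rw [Finset.sum_sub_distrib, ← hVsum, ← hU₀, sub_self]
  have hgood : ∀ s, ∀ᶠ q in F, restrictMatrix (supportIndices (J s)) q.1 *
      restrictMatrix (supportIndices (J s)) (W q s) = 0 := by
    intro s
    have h1 := hJ.eventually_restrictMatrix_mul_eq_zero hX₀ hM (hb s) hδ (hV' s)
    rw [← hVeq s] at h1
    filter_upwards [(hX.prodMk_nhds (hV s)).eventually h1, hW] with q hq hq'
    exact hq hq'.1.1 (rankOneSums_mono supportedZeros_subset (hq'.2.1 s))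
      (trace_mul_eq_zero_of_mem_rankOneSums_supportedZeros (hq'.2.1 s))
  obtain ⟨q, hq, hq'⟩ := ((eventually_all.2 hgood).and hW).exists
  exact hq'.2.2.2 hq

end Decomposition

theorem theorem1 (p : ℕ) (X₀ U₀ : Matrix (Fin p) (Fin p) ℝ)
    (h₀ : (X₀, U₀) ∈ complementaritySet p)
    (hne : (normalizedZeros X₀).Nonempty)
    (m : ℕ) (J : Fin m → Set (Fin p → ℝ)) (hJ : IsMaximumVertexPartition X₀ m J)
    (Jb : Fin m → Set (Fin p → ℝ)) (hJb : ∀ s, IsRankBasis (J s) (Jb s))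
    (assumption_j : StrictlyComplementary U₀ X₀)
    (assumption_jj : LinearIndependent ℝ
      (fun q : (Σ s : Fin m, Sym2 (Jb s)) => pairMatrix q.2))
    (assumption_jjj : ∀ s, ∀ τ ∈ J s, zeroIndices X₀ τ = (supportIndices (J s) : Set (Fin p)))
    (X U : ℝ → Matrix (Fin p) (Fin p) ℝ)
    (ε' : ℝ) (hε' : 0 < ε')
    (hXU : ∀ ε ∈ Set.Icc 0 ε', (X ε, U ε) ∈ complementaritySet p)
    (hX : Tendsto X (𝓝[≥] 0) (𝓝 X₀)) (hU : Tendsto U (𝓝[≥] 0) (𝓝 U₀)) :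
    ∃ ε₀ : ℝ, 0 < ε₀ ∧
      ∃ W : (s : Fin m) → ℝ → Matrix (supportIndices (J s)) (supportIndices (J s)) ℝ,
        ∀ ε ∈ Set.Icc 0 ε₀,
          (∀ s, (W s ε).IsSymm) ∧
          (∀ s, restrictMatrix (supportIndices (J s)) (X ε) * W s ε +
            W s ε * restrictMatrix (supportIndices (J s)) (X ε) = 0) ∧
          U ε = ∑ s, extendMatrix (supportIndices (J s)) (W s ε) := by
  have hev := (hX.prodMk_nhds hU).eventually
    (hJ.1.eventually_exists_sum h₀ assumption_jjj hJb assumption_j assumption_jj)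
  obtain ⟨r, hr, hball⟩ := mem_nhdsGE_iff_exists_Icc_subset.1 hev
  have hr : 0 < r := hr
  have hexists : ∀ ε, ∃ W : Fin m → Matrix (Fin p) (Fin p) ℝ, ε ∈ Set.Icc 0 (min r ε') →
      (∀ s, W s ∈ rankOneSums (supportedZeros (X ε) (supportIndices (J s)))) ∧
        U ε = ∑ s, W s ∧ ∀ s, restrictMatrix (supportIndices (J s)) (X ε) *
          restrictMatrix (supportIndices (J s)) (W s) = 0 := by
    intro ε
    by_cases hε : ε ∈ Set.Icc 0 (min r ε')
    · obtain ⟨W, hW⟩ := hball ⟨hε.1, hε.2.trans (min_le_left _ _)⟩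
        (hXU ε ⟨hε.1, hε.2.trans (min_le_right _ _)⟩)
      exact ⟨W, fun _ => hW⟩
    · exact ⟨0, fun h => absurd h hε⟩
  choose W hW using hexists
  refine ⟨min r ε', lt_min hr hε', fun s ε => restrictMatrix (supportIndices (J s)) (W ε s),
    fun ε hε => ?_⟩
  obtain ⟨h1, h2, h3⟩ := hW ε hε
  have hXε : (X ε).IsSymm := (hXU ε ⟨hε.1, hε.2.trans (min_le_right _ _)⟩).1.1
  have hsymm : ∀ s, (restrictMatrix (supportIndices (J s)) (W ε s)).IsSymm := fun s =>
    isSymm_restrictMatrix (isSymm_of_mem_rankOneSums (h1 s))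
  refine ⟨hsymm, fun s => ?_, ?_⟩
  · have hcomm := congrArg Matrix.transpose (h3 s)
    rw [transpose_mul, (hsymm s).eq, (isSymm_restrictMatrix hXε).eq, transpose_zero] at hcomm
    rw [h3 s, hcomm, add_zero]
  · rw [h2]
    exact Finset.sum_congr rfl fun s _ =>
      (extendMatrix_restrictMatrix (fun v hv => hv.2.1) (h1 s)).symm
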